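/- Let $n\ge 1$ be an integer and $0<s<1$. Put $$C_{n,s}=\frac{s\,2^{2s}\,\Gamma\left(\frac{n+2s}{2}\right)}{\pi^{n/2}\,\Gamma(1-s)} .$$ For an open set $\Omega\subset\mathbb{R}^n$ and a measurable function $u:\Omega\to\mathbb{R}$ put $$[u]_{s,2,\Omega}^2=\frac{C_{n,s}}{2}\int_\Omega\int_\Omega\frac{|u(x)-u(y)|^2}{|x-y|^{n+2s}}\,dx\,dy,\qquad \|u\|_{s,2,\Omega}=\left(\|u\|_{L^2(\Omega)}^2+[u]_{s,2,\Omega}^2\right)^{1/2}.$$ Let $W^{s,2}(\Omega)=\{u\in L^2(\Omega):[u]_{s,2,\Omega}<\infty\}$, let $W^{s,2}_0(\Omega)$ be the closure of $C_c^\infty(\Omega)$ in $W^{s,2}(\Omega)$ with respect to the norm $\|\cdot\|_{s,2,\Omega}$, and define the regional fractional Poincaré constant $$P^1_{n,s}(\Omega)=\inf_{u\in W^{s,2}_0(\Omega),\ u\ne 0}\ \frac{[u]_{s,2,\Omega}^2}{\int_\Omega u^2}.$$ Let $\Omega_\infty=\mathbb{R}^{n-1}\times(-1,1)\subset\mathbb{R}^n$.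 Then: 1. if $0<s\le\frac12$, then $P^1_{n,s}(\Omega_\infty)=P^1_{1,s}((-1,1))=0$; 2. if $\frac12<s<1$, then $P^1_{n,s}(\Omega_\infty)>0$ and $P^1_{n,s}(\Omega_\infty)=P^1_{1,s}((-1,1))$. -/

import Mathlib

open MeasureTheory
open scoped ENNReal ContDiff

/-- The normalizing constant `C_{n,s}` of the fractional Laplacian on `ℝⁿ`, in closed form. -/
noncomputable def fracConst (n : ℕ) (s : ℝ) : ℝ :=
  s * (2 : ℝ) ^ (2 * s) * Real.Gamma (((n : ℝ) + 2 * s) / 2) /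
    (Real.pi ^ ((n : ℝ) / 2) * Real.Gamma (1 - s))

/-- The squared Gagliardo seminorm
`[u]² = (C_{n,s} / 2) ∫_Ω ∫_Ω |u x - u y|² / |x - y|^(n + 2s) dx dy`, with values in `[0, ∞]`.
Only the values of `u` on `Ω` matter. -/
noncomputable def gagliardoSq (n : ℕ) (s : ℝ) (Ω : Set (EuclideanSpace ℝ (Fin n)))
    (u : EuclideanSpace ℝ (Fin n) → ℝ) : ℝ≥0∞ :=
  ENNReal.ofReal (fracConst n s / 2) *
    ∫⁻ x in Ω, ∫⁻ y in Ω, ENNReal.ofReal (|u x - u y| ^ 2 / ‖x - y‖ ^ ((n : ℝ) + 2 * s))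

/-- The squared `L²(Ω)` norm `∫_Ω u²`, with values in `[0, ∞]`. -/
noncomputable def l2Sq (n : ℕ) (Ω : Set (EuclideanSpace ℝ (Fin n)))
    (u : EuclideanSpace ℝ (Fin n) → ℝ) : ℝ≥0∞ :=
  ∫⁻ x in Ω, ENNReal.ofReal (u x ^ 2)

/-- The norm `‖u‖_{s,2,Ω} = (‖u‖²_{L²(Ω)} + [u]²_{s,2,Ω})^(1/2)`, with values in `[0, ∞]`. -/
noncomputable def sobolevNorm (n : ℕ) (s : ℝ) (Ω : Set (EuclideanSpace ℝ (Fin n)))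
    (u : EuclideanSpace ℝ (Fin n) → ℝ) : ℝ≥0∞ :=
  (l2Sq n Ω u + gagliardoSq n s Ω u) ^ (1 / 2 : ℝ)

/-- `u` represents an element of `W^{s,2}(Ω)`. -/
def MemW (n : ℕ) (s : ℝ) (Ω : Set (EuclideanSpace ℝ (Fin n)))
    (u : EuclideanSpace ℝ (Fin n) → ℝ) : Prop :=
  MemLp u 2 (volume.restrict Ω) ∧
    ∫⁻ x in Ω, ∫⁻ y in Ω,
      ENNReal.ofReal (|u x - u y| ^ 2 / ‖x - y‖ ^ ((n : ℝ) + 2 * s)) < ⊤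

/-- `φ ∈ C_c^∞(Ω)`: smooth, with compact support contained in `Ω`. -/
def IsTestFunction (n : ℕ) (Ω : Set (EuclideanSpace ℝ (Fin n)))
    (φ : EuclideanSpace ℝ (Fin n) → ℝ) : Prop :=
  ContDiff ℝ ∞ φ ∧ HasCompactSupport φ ∧ tsupport φ ⊆ Ω

/-- `u` represents an element of `W_0^{s,2}(Ω)`, the closure of `C_c^∞(Ω)` in `W^{s,2}(Ω)` for the
norm `‖·‖_{s,2,Ω}`. -/
def MemW0 (n : ℕ) (s : ℝ) (Ω : Set (EuclideanSpace ℝ (Fin n)))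
    (u : EuclideanSpace ℝ (Fin n) → ℝ) : Prop :=
  MemW n s Ω u ∧
    ∀ ε : ℝ≥0∞, 0 < ε → ∃ φ, IsTestFunction n Ω φ ∧ sobolevNorm n s Ω (fun x => u x - φ x) < ε

/-- The regional fractional Poincaré constant `P¹_{n,s}(Ω)`: the infimum of the Rayleigh quotient
`[u]²_{s,2,Ω} / ∫_Ω u²` over the nonzero elements of `W_0^{s,2}(Ω)`. For such `u` the numerator
is finite and the denominator lies in `(0, ∞)`. -/
noncomputable def regionalPoincare (n : ℕ) (s : ℝ) (Ω : Set (EuclideanSpace ℝ (Fin n))) : ℝ≥0∞ :=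
  ⨅ (u : EuclideanSpace ℝ (Fin n) → ℝ) (_ : MemW0 n s Ω u)
    (_ : ¬ u =ᵐ[volume.restrict Ω] 0), gagliardoSq n s Ω u / l2Sq n Ω u

/-- The strip `ℝ^d × (-1, 1)` in `ℝ^(d+1)`. -/
def strip (d : ℕ) : Set (EuclideanSpace ℝ (Fin (d + 1))) :=
  {x | x (Fin.last d) ∈ Set.Ioo (-1 : ℝ) 1}

/-- The interval `(-1, 1)`, as a subset of one-dimensional Euclidean space. -/
def interval11 : Set (EuclideanSpace ℝ (Fin 1)) :=
  {x | x 0 ∈ Set.Ioo (-1 : ℝ) 1}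

/-! Test functions are dense in the energy space by definition, so a lower bound for a Poincaré
constant is the same as an inequality `c * ‖φ‖² ≤ [φ]²` for test functions
(`le_regionalPoincare_iff`). The strip and the interval are linked by an exact identity: integrating
the kernel `C_{d+1,s} |(z,t)|^(-(d+1+2s))` over `z ∈ ℝ^d` yields `C_{1,s} |t|^(-(1+2s))`
(`fracConst_mul_lintegral_kernel`).

Equality of the two constants, for all `0 < s < 1`, is two inequalities. From a function `u` on the
strip, take `a ↦ ‖u(·,a)‖_{L²(ℝ^d)}`: it has the same `L²` mass, and the reverse triangle inequality
together with translation invariance shows that its energy is no larger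
(`lineEnergy_sqrt_sliceSq_le`). Conversely, given `v` on the interval, use the product `η(x) v(t)`
with a very wide cutoff `η`: after division by `∫ η²` the energy is at most that of `v`, up to an
error that vanishes as `η` flattens (`gagliardoSq_strip_mul_le`).

It remains to treat the interval. For `s > 1/2`, the mass on `(-1, -1 + 2h)` is compared with that
on its left half. Halving repeatedly, the energy terms form a geometric series, convergent exactly
because `s > 1/2`, and the last mass term vanishes because `v` is zero near `-1`
(`exists_lineL2_le`).

For `s ≤ 1/2` it suffices to treat `s = 1/2`, the kernels being comparable on a bounded interval.
That order is scale invariant: cutoffs with boundary layers of width `1/k` have energy bounded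
uniformly in `k`, not small. But cutoffs at very different scales are almost orthogonal
(`tendsto_mixedEnergy_endCutoff`), so the average of `N` of them has energy `O(1/N)` while remaining
`1` on `(-1/2, 1/2)`. -/

/-! ### Coordinates and Fubini on the strip and the interval -/

/-- The point `(x, t)` of `ℝ^(d+1)`. -/
noncomputable def snocPoint {d : ℕ} (x : EuclideanSpace ℝ (Fin d)) (t : ℝ) :
    EuclideanSpace ℝ (Fin (d + 1)) :=
  WithLp.toLp 2 ((Fin.last d).insertNth t x.ofLp)

@[simp] theorem snocPoint_last {d : ℕ} (x : EuclideanSpace ℝ (Fin d)) (t : ℝ) :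
    snocPoint x t (Fin.last d) = t := by
  simp [snocPoint]

@[simp] theorem snocPoint_castSucc {d : ℕ} (x : EuclideanSpace ℝ (Fin d)) (t : ℝ) (i : Fin d) :
    snocPoint x t i.castSucc = x i := by
  have := Fin.insertNth_apply_succAbove (α := fun _ => ℝ) (Fin.last d) t x.ofLp i
  rw [Fin.succAbove_last] at this
  exact this

theorem norm_snocPoint_sub_sq {d : ℕ} (x y : EuclideanSpace ℝ (Fin d)) (t r : ℝ) :
    ‖snocPoint x t - snocPoint y r‖ ^ 2 = ‖x - y‖ ^ 2 + (t - r) ^ 2 := by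
  rw [EuclideanSpace.norm_sq_eq, EuclideanSpace.norm_sq_eq, Fin.sum_univ_castSucc]
  simp

theorem contDiff_snocPoint {d : ℕ} :
    ContDiff ℝ ∞ (fun p : EuclideanSpace ℝ (Fin d) × ℝ => snocPoint p.1 p.2) := by
  rw [contDiff_euclidean]
  intro i
  refine Fin.lastCases ?_ (fun j => ?_) i
  · simpa using contDiff_snd
  · simp only [snocPoint_castSucc]
    fun_prop

theorem continuous_snocPoint {d : ℕ} :
    Continuous (fun p : EuclideanSpace ℝ (Fin d) × ℝ => snocPoint p.1 p.2) :=
  contDiff_snocPoint.continuous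

theorem measurePreserving_snocPoint (d : ℕ) :
    MeasurePreserving (fun p : ℝ × EuclideanSpace ℝ (Fin d) => snocPoint p.2 p.1)
      (volume.prod volume) volume := by
  have h1 := (volume_preserving_piFinSuccAbove (fun _ : Fin (d + 1) => ℝ) (Fin.last d)).symm
  have h2 : MeasurePreserving (Prod.map id (WithLp.ofLp) :
      ℝ × EuclideanSpace ℝ (Fin d) → ℝ × (Fin d → ℝ)) (volume.prod volume)
      (volume.prod volume) :=
    (MeasurePreserving.id volume).prod (PiLp.volume_preserving_ofLp (Fin d))
  exact (PiLp.volume_preserving_toLp (Fin (d + 1))).comp (h1.comp h2)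

theorem lintegral_eq_lintegral_snocPoint {d : ℕ} {f : EuclideanSpace ℝ (Fin (d + 1)) → ℝ≥0∞}
    (hf : Measurable f) : ∫⁻ z, f z = ∫⁻ t, ∫⁻ x, f (snocPoint x t) := by
  rw [← (measurePreserving_snocPoint d).lintegral_comp hf, lintegral_prod]
  exact (hf.comp (measurePreserving_snocPoint d).measurable).aemeasurable

theorem measurableSet_strip (d : ℕ) : MeasurableSet (strip d) := by
  have : Measurable (fun x : EuclideanSpace ℝ (Fin (d + 1)) => x (Fin.last d)) := by fun_prop
  exact this measurableSet_Ioo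

theorem setLIntegral_strip {d : ℕ} {f : EuclideanSpace ℝ (Fin (d + 1)) → ℝ≥0∞}
    (hf : Measurable f) :
    ∫⁻ z in strip d, f z = ∫⁻ t in Set.Ioo (-1 : ℝ) 1, ∫⁻ x, f (snocPoint x t) := by
  rw [← lintegral_indicator (measurableSet_strip d),
    lintegral_eq_lintegral_snocPoint (hf.indicator (measurableSet_strip d)),
    ← lintegral_indicator measurableSet_Ioo]
  refine lintegral_congr fun t => ?_
  by_cases ht : t ∈ Set.Ioo (-1 : ℝ) 1
  · rw [Set.indicator_of_mem ht]
    refine lintegral_congr fun x => Set.indicator_of_mem ?_ _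
    simpa [strip] using ht
  · rw [Set.indicator_of_notMem ht]
    refine (lintegral_congr fun x => Set.indicator_of_notMem ?_ _).trans lintegral_zero
    simpa [strip] using ht

/-- The real number `t` as a point of one-dimensional Euclidean space. -/
noncomputable def toLine (t : ℝ) : EuclideanSpace ℝ (Fin 1) := WithLp.toLp 2 fun _ => t

@[simp] theorem toLine_apply (t : ℝ) (i : Fin 1) : toLine t i = t := rfl

theorem norm_toLine_sub (t r : ℝ) : ‖toLine t - toLine r‖ = |t - r| := by
  rw [EuclideanSpace.norm_eq]
  simp [Real.sqrt_sq_eq_abs]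

theorem contDiff_toLine : ContDiff ℝ ∞ toLine := by
  rw [contDiff_euclidean]
  intro i
  exact contDiff_id

theorem toLine_apply_zero (x : EuclideanSpace ℝ (Fin 1)) : toLine (x 0) = x := by
  ext i
  rw [Subsingleton.elim i 0]
  rfl

theorem measurePreserving_toLine : MeasurePreserving toLine :=
  (PiLp.volume_preserving_toLp (Fin 1)).comp (volume_preserving_funUnique (Fin 1) ℝ).symm

theorem measurableEmbedding_toLine : MeasurableEmbedding toLine :=
  ((MeasurableEquiv.funUnique (Fin 1) ℝ).symm.trans
    (MeasurableEquiv.toLp 2 (Fin 1 → ℝ))).measurableEmbedding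

theorem setLIntegral_interval11 (f : EuclideanSpace ℝ (Fin 1) → ℝ≥0∞) :
    ∫⁻ z in interval11, f z = ∫⁻ t in Set.Ioo (-1 : ℝ) 1, f (toLine t) := by
  rw [← measurePreserving_toLine.setLIntegral_comp_preimage_emb measurableEmbedding_toLine]
  rfl

/-! ### Limiting arguments in `[0, ∞]` and weighted squares -/

open Filter Topology in
theorem ENNReal.le_of_forall_le_one_add_mul {a b : ℝ≥0∞}
    (h : ∀ δ : ℝ, 0 < δ → a ≤ ENNReal.ofReal (1 + δ) * b) : a ≤ b := by
  have h1 : Tendsto (fun δ : ℝ => ENNReal.ofReal (1 + δ)) (𝓝[>] 0) (𝓝 1) := by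
    have : Tendsto (fun δ : ℝ => ENNReal.ofReal (1 + δ)) (𝓝 0) (𝓝 (ENNReal.ofReal (1 + 0))) :=
      (ENNReal.continuous_ofReal.comp (continuous_const.add continuous_id)).tendsto 0
    simp only [add_zero, ENNReal.ofReal_one] at this
    exact this.mono_left nhdsWithin_le_nhds
  have h2 := ENNReal.Tendsto.mul_const (b := b) h1 (Or.inl one_ne_zero)
  rw [one_mul] at h2
  refine ge_of_tendsto h2 ?_
  filter_upwards [self_mem_nhdsWithin] with δ hδ using h δ hδ

theorem ENNReal.le_of_forall_le_add_mul {a b K : ℝ≥0∞} (hK : K ≠ ⊤)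
    (h : ∀ e : ℝ≥0∞, 0 < e → a ≤ b + K * e) : a ≤ b := by
  refine ENNReal.le_of_forall_pos_le_add fun ε hε _ => ?_
  have hK1 : K + 1 ≠ ⊤ := by simp [hK]
  refine (h (ε / (K + 1)) (ENNReal.div_pos (by exact_mod_cast hε.ne') hK1)).trans ?_
  gcongr
  calc K * (ε / (K + 1)) ≤ (K + 1) * (ε / (K + 1)) := by gcongr; exact le_self_add
    _ = ε := ENNReal.mul_div_cancel (by simp) hK1

/-- The gap between the two sides is `(δ a - b)² / δ`. The weight of the main term `a²` can be
brought as close to `1` as desired, so sharp constants survive when `b` is a small error. -/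
theorem sq_add_le_weighted {δ : ℝ} (hδ : 0 < δ) (a b : ℝ) :
    (a + b) ^ 2 ≤ (1 + δ) * a ^ 2 + (1 + 1 / δ) * b ^ 2 := by
  have h : 0 ≤ (δ * a - b) ^ 2 / δ := by positivity
  have h2 : (δ * a - b) ^ 2 / δ = δ * a ^ 2 - 2 * a * b + 1 / δ * b ^ 2 := by
    field_simp
    ring
  nlinarith

theorem ofReal_sq_add_div_le {δ : ℝ} (hδ : 0 < δ) (a b : ℝ) {k : ℝ} (hk : 0 ≤ k) :
    ENNReal.ofReal ((a + b) ^ 2 / k) ≤ ENNReal.ofReal (1 + δ) * ENNReal.ofReal (a ^ 2 / k) +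
      ENNReal.ofReal (1 + 1 / δ) * ENNReal.ofReal (b ^ 2 / k) := by
  rw [← ENNReal.ofReal_mul (by positivity), ← ENNReal.ofReal_mul (by positivity),
    ← ENNReal.ofReal_add (by positivity) (by positivity)]
  apply ENNReal.ofReal_le_ofReal
  calc (a + b) ^ 2 / k ≤ ((1 + δ) * a ^ 2 + (1 + 1 / δ) * b ^ 2) / k := by
        gcongr
        exact sq_add_le_weighted hδ a b
    _ = _ := by ring

theorem fracConst_pos (n : ℕ) {s : ℝ} (hs : 0 < s) (hs1 : s < 1) : 0 < fracConst n s := by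
  unfold fracConst
  have h1 : 0 < Real.Gamma (((n : ℝ) + 2 * s) / 2) := Real.Gamma_pos_of_pos (by positivity)
  have h2 : 0 < Real.Gamma (1 - s) := Real.Gamma_pos_of_pos (by linarith)
  positivity

/-! ### Reduction to test functions -/

section

variable {n : ℕ} {s : ℝ} {Ω : Set (EuclideanSpace ℝ (Fin n))}

theorem aemeasurable_gagliardo_integrand {μ : Measure (EuclideanSpace ℝ (Fin n))} [SFinite μ]
    {u : EuclideanSpace ℝ (Fin n) → ℝ} (hu : AEMeasurable u μ) (p : ℝ) :
    AEMeasurable (fun z : EuclideanSpace ℝ (Fin n) × EuclideanSpace ℝ (Fin n) =>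
      ENNReal.ofReal (|u z.1 - u z.2| ^ 2 / ‖z.1 - z.2‖ ^ p)) (μ.prod μ) := by
  have h1 : AEMeasurable (fun z : EuclideanSpace ℝ (Fin n) × EuclideanSpace ℝ (Fin n) =>
    u z.1) (μ.prod μ) := hu.comp_fst
  have h2 : AEMeasurable (fun z : EuclideanSpace ℝ (Fin n) × EuclideanSpace ℝ (Fin n) =>
    u z.2) (μ.prod μ) := hu.comp_snd
  have h3 : AEMeasurable (fun z : EuclideanSpace ℝ (Fin n) × EuclideanSpace ℝ (Fin n) =>
    ‖z.1 - z.2‖ ^ p) (μ.prod μ) := by fun_prop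
  fun_prop

theorem gagliardoSq_add_le {u w : EuclideanSpace ℝ (Fin n) → ℝ} {δ : ℝ} (hδ : 0 < δ)
    (hu : AEMeasurable u (volume.restrict Ω)) :
    gagliardoSq n s Ω (fun x => u x + w x) ≤
      ENNReal.ofReal (1 + δ) * gagliardoSq n s Ω u +
        ENNReal.ofReal (1 + 1 / δ) * gagliardoSq n s Ω w := by
  unfold gagliardoSq
  rw [mul_left_comm, mul_left_comm (ENNReal.ofReal (1 + 1 / δ)), ← mul_add]
  gcongr
  have hF := aemeasurable_gagliardo_integrand hu ((n : ℝ) + 2 * s)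
  calc _ ≤ ∫⁻ x in Ω, ∫⁻ y in Ω, (ENNReal.ofReal (1 + δ) *
          ENNReal.ofReal (|u x - u y| ^ 2 / ‖x - y‖ ^ ((n : ℝ) + 2 * s)) +
          ENNReal.ofReal (1 + 1 / δ) *
          ENNReal.ofReal (|w x - w y| ^ 2 / ‖x - y‖ ^ ((n : ℝ) + 2 * s))) := by
        gcongr with x y
        simp only [sq_abs]
        rw [show u x + w x - (u y + w y) = (u x - u y) + (w x - w y) by ring]
        exact ofReal_sq_add_div_le hδ _ _ (by positivity)
    _ = ∫⁻ x in Ω, (ENNReal.ofReal (1 + δ) * (∫⁻ y in Ω,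
          ENNReal.ofReal (|u x - u y| ^ 2 / ‖x - y‖ ^ ((n : ℝ) + 2 * s))) +
          ENNReal.ofReal (1 + 1 / δ) * ∫⁻ y in Ω,
          ENNReal.ofReal (|w x - w y| ^ 2 / ‖x - y‖ ^ ((n : ℝ) + 2 * s))) := by
        refine lintegral_congr fun x => ?_
        have h3 : AEMeasurable (fun y => ‖x - y‖ ^ ((n : ℝ) + 2 * s)) (volume.restrict Ω) := by
          fun_prop
        rw [lintegral_add_left', lintegral_const_mul' _ _ ENNReal.ofReal_ne_top,
          lintegral_const_mul' _ _ ENNReal.ofReal_ne_top]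
        fun_prop
    _ = _ := by
        rw [lintegral_add_left', lintegral_const_mul' _ _ ENNReal.ofReal_ne_top,
          lintegral_const_mul' _ _ ENNReal.ofReal_ne_top]
        exact hF.lintegral_prod_right'.const_mul _

theorem l2Sq_add_le {u w : EuclideanSpace ℝ (Fin n) → ℝ} {δ : ℝ} (hδ : 0 < δ)
    (hu : AEMeasurable u (volume.restrict Ω)) :
    l2Sq n Ω (fun x => u x + w x) ≤
      ENNReal.ofReal (1 + δ) * l2Sq n Ω u + ENNReal.ofReal (1 + 1 / δ) * l2Sq n Ω w := by
  unfold l2Sq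
  rw [← lintegral_const_mul' _ _ ENNReal.ofReal_ne_top,
    ← lintegral_const_mul' _ _ ENNReal.ofReal_ne_top, ← lintegral_add_left' (by fun_prop)]
  gcongr with x
  simpa using ofReal_sq_add_div_le hδ (u x) (w x) zero_le_one

theorem gagliardoSq_neg (u : EuclideanSpace ℝ (Fin n) → ℝ) :
    gagliardoSq n s Ω (fun x => -u x) = gagliardoSq n s Ω u := by
  unfold gagliardoSq
  simp_rw [← neg_sub', abs_neg]

theorem IsTestFunction.continuous {φ : EuclideanSpace ℝ (Fin n) → ℝ}
    (h : IsTestFunction n Ω φ) : Continuous φ := h.1.continuous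

theorem IsTestFunction.l2Sq_ne_top {φ : EuclideanSpace ℝ (Fin n) → ℝ}
    (h : IsTestFunction n Ω φ) : l2Sq n Ω φ ≠ ⊤ := by
  have h1 : MemLp φ 2 (volume : Measure (EuclideanSpace ℝ (Fin n))) :=
    h.continuous.memLp_of_hasCompactSupport h.2.1
  have h2 := (h1.restrict Ω).integrable_sq.lintegral_lt_top
  exact h2.ne

theorem l2Sq_eq_zero_iff {u : EuclideanSpace ℝ (Fin n) → ℝ}
    (hu : AEMeasurable u (volume.restrict Ω)) :
    l2Sq n Ω u = 0 ↔ u =ᵐ[volume.restrict Ω] 0 := by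
  unfold l2Sq
  rw [lintegral_eq_zero_iff' (by fun_prop)]
  refine Filter.eventually_congr (Filter.Eventually.of_forall fun x => ?_)
  simp [sq_nonpos_iff]

theorem IsTestFunction.memW0 {φ : EuclideanSpace ℝ (Fin n) → ℝ}
    (h : IsTestFunction n Ω φ) (hs : 0 < s) (hs1 : s < 1) (hg : gagliardoSq n s Ω φ ≠ ⊤) :
    MemW0 n s Ω φ := by
  refine ⟨⟨(h.continuous.memLp_of_hasCompactSupport h.2.1).restrict Ω, ?_⟩, fun ε hε =>
    ⟨φ, h, ?_⟩⟩
  · by_contra hcon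
    rw [not_lt, top_le_iff] at hcon
    refine hg ?_
    unfold gagliardoSq
    rw [hcon, ENNReal.mul_top]
    simpa using fracConst_pos n hs hs1
  · simpa [sobolevNorm, l2Sq, gagliardoSq] using hε

/-- The infimum defining the Poincaré constant may be computed on test functions. -/
theorem le_regionalPoincare_iff (hs : 0 < s) (hs1 : s < 1) {c : ℝ≥0∞} (hc : c ≠ ⊤) :
    c ≤ regionalPoincare n s Ω ↔
      ∀ φ, IsTestFunction n Ω φ → c * l2Sq n Ω φ ≤ gagliardoSq n s Ω φ := by
  constructor
  · intro h φ hφ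
    by_cases hg : gagliardoSq n s Ω φ = ⊤
    · simp [hg]
    by_cases h0 : φ =ᵐ[volume.restrict Ω] 0
    · simp [(l2Sq_eq_zero_iff hφ.continuous.aemeasurable).2 h0]
    · have h1 : c ≤ gagliardoSq n s Ω φ / l2Sq n Ω φ :=
        h.trans (iInf_le_of_le φ (iInf_le_of_le (hφ.memW0 hs hs1 hg) (iInf_le _ h0)))
      have h2 : l2Sq n Ω φ ≠ 0 := mt (l2Sq_eq_zero_iff hφ.continuous.aemeasurable).1 h0
      exact (ENNReal.le_div_iff_mul_le (Or.inl h2) (Or.inl hφ.l2Sq_ne_top)).1 h1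
  · intro h
    refine le_iInf fun u => le_iInf fun hu => le_iInf fun h0 => ?_
    have hum : AEMeasurable u (volume.restrict Ω) := hu.1.1.1.aemeasurable
    suffices hmain : c * l2Sq n Ω u ≤ gagliardoSq n s Ω u by
      have hl0 : l2Sq n Ω u ≠ 0 := mt (l2Sq_eq_zero_iff hum).1 h0
      have hlt : l2Sq n Ω u ≠ ⊤ := hu.1.1.integrable_sq.lintegral_lt_top.ne
      exact (ENNReal.le_div_iff_mul_le (Or.inl hl0) (Or.inl hlt)).2 hmain
    -- Two independent slacks: `δ` for replacing `u` by `φ` in the `L²` norm, `η` for replacing `φ`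
    -- by `u` in the energy. `K` below collects the coefficients of the approximation error `e`.
    refine ENNReal.le_of_forall_le_one_add_mul fun δ hδ => ?_
    refine ENNReal.le_of_forall_le_one_add_mul fun η hη => ?_
    set K : ℝ≥0∞ := ENNReal.ofReal (1 + δ) * ENNReal.ofReal (1 + 1 / η) +
      c * ENNReal.ofReal (1 + 1 / δ) with hK
    refine ENNReal.le_of_forall_le_add_mul (K := K) (by finiteness) fun e he => ?_
    -- The square root is there because `sobolevNorm` is the root of the sum of squares that has to
    -- be below `e`.
    obtain ⟨φ, hφ, hlt⟩ := hu.2 (e ^ (1 / 2 : ℝ)) (by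
      by_cases het : e = ⊤
      · simp [het]
      · exact ENNReal.rpow_pos he het)
    unfold sobolevNorm at hlt
    rw [ENNReal.rpow_lt_rpow_iff (by norm_num)] at hlt
    set w : EuclideanSpace ℝ (Fin n) → ℝ := fun x => u x - φ x with hw
    have hl : l2Sq n Ω w ≤ e := le_self_add.trans hlt.le
    have hg : gagliardoSq n s Ω w ≤ e := le_add_self.trans hlt.le
    have hu_eq : u = fun x => φ x + w x := by ext x; simp [hw]
    have hφ_eq : φ = fun x => u x + -w x := by ext x; simp [hw]
    have h1 : l2Sq n Ω u ≤ ENNReal.ofReal (1 + δ) * l2Sq n Ω φ +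
        ENNReal.ofReal (1 + 1 / δ) * e := by
      conv_lhs => rw [hu_eq]
      refine (l2Sq_add_le hδ hφ.continuous.aemeasurable).trans ?_
      gcongr
    have h2 : gagliardoSq n s Ω φ ≤ ENNReal.ofReal (1 + η) * gagliardoSq n s Ω u +
        ENNReal.ofReal (1 + 1 / η) * e := by
      conv_lhs => rw [hφ_eq]
      refine (gagliardoSq_add_le hη hum).trans ?_
      rw [gagliardoSq_neg]
      gcongr
    calc c * l2Sq n Ω u ≤ c * (ENNReal.ofReal (1 + δ) * l2Sq n Ω φ +
          ENNReal.ofReal (1 + 1 / δ) * e) := by gcongr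
      _ = ENNReal.ofReal (1 + δ) * (c * l2Sq n Ω φ) + c * ENNReal.ofReal (1 + 1 / δ) * e := by ring
      _ ≤ ENNReal.ofReal (1 + δ) * (ENNReal.ofReal (1 + η) * gagliardoSq n s Ω u +
        ENNReal.ofReal (1 + 1 / η) * e) + c * ENNReal.ofReal (1 + 1 / δ) * e := by
          gcongr
          exact (h φ hφ).trans h2
      _ = _ := by rw [hK]; ring

end

/-! ### Integrating out the unbounded directions of the kernel -/

theorem lintegral_rpow_mul_exp_neg {a r : ℝ} (ha : 0 < a) (hr : 0 < r) :
    ∫⁻ t in Set.Ioi (0 : ℝ), ENNReal.ofReal (t ^ (a - 1) * Real.exp (-(r * t))) =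
      ENNReal.ofReal ((1 / r) ^ a * Real.Gamma a) := by
  have h := Real.integral_rpow_mul_exp_neg_mul_Ioi ha hr
  have hpos : 0 < (1 / r) ^ a * Real.Gamma a :=
    mul_pos (by positivity) (Real.Gamma_pos_of_pos ha)
  rw [← h]
  refine (ofReal_integral_eq_lintegral_ofReal ?_ ?_).symm
  -- A non-integrable function has Bochner integral `0`, so a nonzero value already forces
  -- integrability.
  · exact .of_integral_ne_zero (h ▸ hpos.ne')
  · filter_upwards [ae_restrict_mem measurableSet_Ioi] with t ht
    have : 0 < t := ht
    positivity

theorem lintegral_exp_neg_mul_sq_norm (d : ℕ) {r : ℝ} (hr : 0 < r) :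
    ∫⁻ z : EuclideanSpace ℝ (Fin d), ENNReal.ofReal (Real.exp (-r * ‖z‖ ^ 2)) =
      ENNReal.ofReal ((Real.pi / r) ^ ((d : ℝ) / 2)) := by
  have h := GaussianFourier.integral_rexp_neg_mul_sq_norm (V := EuclideanSpace ℝ (Fin d)) hr
  rw [finrank_euclideanSpace_fin] at h
  rw [← h]
  refine (ofReal_integral_eq_lintegral_ofReal ?_ ?_).symm
  · refine .of_integral_ne_zero (h ▸ ?_)
    have := Real.pi_pos
    positivity
  · exact Filter.Eventually.of_forall fun t => (Real.exp_pos _).le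

/-- Integrating the `(d+1)`-dimensional kernel over `ℝ^d` gives the one-dimensional kernel. -/
theorem lintegral_kernel (d : ℕ) {s : ℝ} (hs : 0 < s) {t : ℝ} (ht : t ≠ 0) :
    ∫⁻ z : EuclideanSpace ℝ (Fin d),
      ENNReal.ofReal (1 / (‖z‖ ^ 2 + t ^ 2) ^ (((d + 1 : ℕ) + 2 * s) / 2)) =
      ENNReal.ofReal (Real.pi ^ ((d : ℝ) / 2) * Real.Gamma ((1 + 2 * s) / 2) /
        Real.Gamma (((d + 1 : ℕ) + 2 * s) / 2) * (1 / |t| ^ (1 + 2 * s))) := by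
  set p : ℝ := ((d + 1 : ℕ) + 2 * s) / 2 with hp
  have hp0 : 0 < p := by positivity
  have hG : 0 < Real.Gamma p := Real.Gamma_pos_of_pos hp0
  have ht2 : 0 < t ^ 2 := by positivity
  have hpd : p - d / 2 = (1 + 2 * s) / 2 := by rw [hp]; push_cast; ring
  have hpt : (1 / t ^ 2) ^ ((1 + 2 * s) / 2) = 1 / |t| ^ (1 + 2 * s) := by
    rw [Real.div_rpow zero_le_one ht2.le, Real.one_rpow, ← sq_abs, ← Real.rpow_natCast,
      ← Real.rpow_mul (abs_nonneg t)]
    congr 2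
    push_cast
    ring
  -- Subordination to Gaussians: write `Γ(p) A^(-p) = ∫ r^(p-1) e^(-A r) dr` with `A = ‖z‖² + t²`
  -- and exchange integrals. The Gaussian in `z` contributes `(π/r)^(d/2)`, which lowers the
  -- exponent to `p - d/2 = (1 + 2s)/2` and leaves another Gamma integral.
  have key : ENNReal.ofReal (Real.Gamma p) * ∫⁻ z : EuclideanSpace ℝ (Fin d),
      ENNReal.ofReal (1 / (‖z‖ ^ 2 + t ^ 2) ^ p) =
      ENNReal.ofReal (Real.pi ^ ((d : ℝ) / 2) *
        ((1 / t ^ 2) ^ ((1 + 2 * s) / 2) * Real.Gamma ((1 + 2 * s) / 2))) := by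
    calc _ = ∫⁻ z : EuclideanSpace ℝ (Fin d), ∫⁻ r in Set.Ioi (0 : ℝ),
          ENNReal.ofReal (r ^ (p - 1) * Real.exp (-((‖z‖ ^ 2 + t ^ 2) * r))) := by
          rw [← lintegral_const_mul' _ _ ENNReal.ofReal_ne_top]
          refine lintegral_congr fun z => ?_
          rw [lintegral_rpow_mul_exp_neg hp0 (by positivity), ← ENNReal.ofReal_mul hG.le,
            Real.div_rpow zero_le_one (by positivity), Real.one_rpow, mul_comm]
      _ = ∫⁻ r in Set.Ioi (0 : ℝ), ∫⁻ z : EuclideanSpace ℝ (Fin d),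
          ENNReal.ofReal (r ^ (p - 1) * Real.exp (-((‖z‖ ^ 2 + t ^ 2) * r))) := by
          refine lintegral_lintegral_swap ?_
          refine Measurable.aemeasurable ?_
          simp only [Function.uncurry_def]
          fun_prop
      _ = ∫⁻ r in Set.Ioi (0 : ℝ), ENNReal.ofReal (Real.pi ^ ((d : ℝ) / 2)) *
          ENNReal.ofReal (r ^ ((1 + 2 * s) / 2 - 1) * Real.exp (-(t ^ 2 * r))) := by
          refine setLIntegral_congr_fun measurableSet_Ioi fun r hr => ?_
          have hr : 0 < r := hr
          have h1 : ∀ z : EuclideanSpace ℝ (Fin d),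
              ENNReal.ofReal (r ^ (p - 1) * Real.exp (-((‖z‖ ^ 2 + t ^ 2) * r))) =
              ENNReal.ofReal (r ^ (p - 1) * Real.exp (-(t ^ 2 * r))) *
                ENNReal.ofReal (Real.exp (-r * ‖z‖ ^ 2)) := by
            intro z
            rw [← ENNReal.ofReal_mul (by positivity), mul_assoc, ← Real.exp_add]
            congr 3
            ring
          simp_rw [h1]
          rw [lintegral_const_mul' _ _ ENNReal.ofReal_ne_top, lintegral_exp_neg_mul_sq_norm d hr,
            ← ENNReal.ofReal_mul (by positivity), ← ENNReal.ofReal_mul (by positivity)]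
          congr 1
          rw [Real.div_rpow Real.pi_pos.le hr.le, ← hpd,
            show p - d / 2 - 1 = (p - 1) - d / 2 by ring, Real.rpow_sub hr (p - 1)]
          ring
      _ = _ := by
          rw [lintegral_const_mul' _ _ ENNReal.ofReal_ne_top,
            lintegral_rpow_mul_exp_neg (by positivity) ht2,
            ← ENNReal.ofReal_mul (Real.rpow_nonneg Real.pi_pos.le _)]
  rw [hpt] at key
  have hG' : ENNReal.ofReal (Real.Gamma p) ≠ 0 := by simpa using hG
  rw [← ENNReal.mul_right_inj hG' ENNReal.ofReal_ne_top, key, ← ENNReal.ofReal_mul hG.le]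
  congr 1
  field_simp

/-- The Gamma factor and the power of `π` in `fracConst` are precisely those produced by the
marginal of the kernel. This cancellation is why no dimensional factor separates the two Poincaré
constants. -/
theorem fracConst_mul_lintegral_kernel (d : ℕ) {s : ℝ} (hs : 0 < s) (hs1 : s < 1) {t : ℝ}
    (ht : t ≠ 0) :
    ENNReal.ofReal (fracConst (d + 1) s / 2) * ∫⁻ z : EuclideanSpace ℝ (Fin d),
      ENNReal.ofReal (1 / (‖z‖ ^ 2 + t ^ 2) ^ (((d + 1 : ℕ) + 2 * s) / 2)) =
      ENNReal.ofReal (fracConst 1 s / 2) * ENNReal.ofReal (1 / |t| ^ (1 + 2 * s)) := by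
  rw [lintegral_kernel d hs ht, ← ENNReal.ofReal_mul (by linarith [fracConst_pos (d + 1) hs hs1]),
    ← ENNReal.ofReal_mul (by linarith [fracConst_pos 1 hs hs1]), ← mul_assoc]
  congr 2
  unfold fracConst
  have h1 : Real.Gamma (((d + 1 : ℕ) + 2 * s) / 2) ≠ 0 :=
    (Real.Gamma_pos_of_pos (by positivity)).ne'
  have h2 : Real.Gamma (1 - s) ≠ 0 := (Real.Gamma_pos_of_pos (by linarith)).ne'
  have h3 : Real.pi ^ (((d + 1 : ℕ) : ℝ) / 2) =
      Real.pi ^ ((d : ℝ) / 2) * Real.pi ^ (((1 : ℕ) : ℝ) / 2) := by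
    rw [← Real.rpow_add Real.pi_pos]
    congr 1
    push_cast
    ring
  have h4 : Real.pi ^ ((d : ℝ) / 2) ≠ 0 := (Real.rpow_pos_of_pos Real.pi_pos _).ne'
  have h5 : Real.pi ^ (((1 : ℕ) : ℝ) / 2) ≠ 0 := (Real.rpow_pos_of_pos Real.pi_pos _).ne'
  rw [h3]
  field_simp
  simp

theorem norm_snocPoint_sub_rpow {d : ℕ} (x y : EuclideanSpace ℝ (Fin d)) (t r p : ℝ) :
    ‖snocPoint x t - snocPoint y r‖ ^ p = (‖x - y‖ ^ 2 + (t - r) ^ 2) ^ (p / 2) := by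
  rw [← norm_snocPoint_sub_sq, ← Real.rpow_natCast, ← Real.rpow_mul (norm_nonneg _)]
  congr 1
  push_cast
  ring

/-! ### The interval problem on the real line -/

/-- Smooth functions on the line with compact support in `(-1, 1)`. -/
def IsLineTest (v : ℝ → ℝ) : Prop :=
  ContDiff ℝ ∞ v ∧ HasCompactSupport v ∧ tsupport v ⊆ Set.Ioo (-1 : ℝ) 1

/-- The double integral in the squared Gagliardo seminorm on `(-1, 1)`. -/
noncomputable def lineEnergy (s : ℝ) (v : ℝ → ℝ) : ℝ≥0∞ :=
  ∫⁻ a in Set.Ioo (-1 : ℝ) 1, ∫⁻ b in Set.Ioo (-1 : ℝ) 1,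
    ENNReal.ofReal ((v a - v b) ^ 2 / |a - b| ^ (1 + 2 * s))

/-- The squared `L²` norm on `(-1, 1)`. -/
noncomputable def lineL2 (v : ℝ → ℝ) : ℝ≥0∞ :=
  ∫⁻ a in Set.Ioo (-1 : ℝ) 1, ENNReal.ofReal (v a ^ 2)

theorem gagliardoSq_interval11 (s : ℝ) (u : EuclideanSpace ℝ (Fin 1) → ℝ) :
    gagliardoSq 1 s interval11 u =
      ENNReal.ofReal (fracConst 1 s / 2) * lineEnergy s (fun t => u (toLine t)) := by
  unfold gagliardoSq lineEnergy
  simp_rw [setLIntegral_interval11, norm_toLine_sub, sq_abs]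
  simp

theorem l2Sq_interval11 (u : EuclideanSpace ℝ (Fin 1) → ℝ) :
    l2Sq 1 interval11 u = lineL2 (fun t => u (toLine t)) :=
  setLIntegral_interval11 _

/-- The line and one-dimensional Euclidean space are homeomorphic. -/
noncomputable def toLineHomeo : ℝ ≃ₜ EuclideanSpace ℝ (Fin 1) where
  toFun := toLine
  invFun x := x 0
  left_inv t := rfl
  right_inv := toLine_apply_zero
  continuous_toFun := contDiff_toLine.continuous
  continuous_invFun := by fun_prop

theorem tsupport_comp_toLine (φ : EuclideanSpace ℝ (Fin 1) → ℝ) :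
    tsupport (fun t => φ (toLine t)) = toLine ⁻¹' tsupport φ :=
  tsupport_comp_eq_preimage φ toLineHomeo

theorem IsTestFunction.isLineTest {φ : EuclideanSpace ℝ (Fin 1) → ℝ}
    (h : IsTestFunction 1 interval11 φ) : IsLineTest (fun t => φ (toLine t)) := by
  refine ⟨h.1.comp contDiff_toLine, h.2.1.comp_homeomorph toLineHomeo, ?_⟩
  rw [tsupport_comp_toLine]
  exact fun t ht => h.2.2 ht

theorem IsLineTest.isTestFunction {v : ℝ → ℝ} (h : IsLineTest v) :
    IsTestFunction 1 interval11 (fun x => v (x 0)) := by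
  refine ⟨h.1.comp (by fun_prop), h.2.1.comp_homeomorph toLineHomeo.symm, ?_⟩
  have h1 : tsupport (fun x : EuclideanSpace ℝ (Fin 1) => v (x 0)) =
      (fun x => x 0) ⁻¹' tsupport v := tsupport_comp_eq_preimage v toLineHomeo.symm
  rw [h1]
  exact fun x hx => h.2.2 hx

theorem le_regionalPoincare_interval11_iff {s : ℝ} (hs : 0 < s) (hs1 : s < 1) {c : ℝ≥0∞}
    (hc : c ≠ ⊤) :
    c ≤ regionalPoincare 1 s interval11 ↔
      ∀ v, IsLineTest v → c * lineL2 v ≤ ENNReal.ofReal (fracConst 1 s / 2) * lineEnergy s v := by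
  rw [le_regionalPoincare_iff hs hs1 hc]
  constructor
  · intro h v hv
    have := h _ hv.isTestFunction
    rwa [gagliardoSq_interval11, l2Sq_interval11] at this
  · intro h φ hφ
    rw [gagliardoSq_interval11, l2Sq_interval11]
    exact h _ hφ.isLineTest

/-! ### Reverse triangle inequalities -/

/-- The reverse triangle inequality of `L²`, squared. Expanding both sides reduces it to
Cauchy–Schwarz for `∫ f g`. -/
theorem sq_sqrt_integral_sub_le {α : Type*} [MeasurableSpace α] {μ : Measure α} {f g : α → ℝ}
    (hf : MemLp f 2 μ) (hg : MemLp g 2 μ) :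
    (√(∫ x, f x ^ 2 ∂μ) - √(∫ x, g x ^ 2 ∂μ)) ^ 2 ≤ ∫ x, (f x - g x) ^ 2 ∂μ := by
  have hff := hf.integrable_sq
  have hgg := hg.integrable_sq
  have hfg : Integrable (fun x => f x * g x) μ := hf.integrable_mul hg
  have hexp : ∀ t : ℝ, ∫ x, (f x - t * g x) ^ 2 ∂μ =
      (∫ x, f x ^ 2 ∂μ) - 2 * t * (∫ x, f x * g x ∂μ) + t ^ 2 * ∫ x, g x ^ 2 ∂μ := by
    intro t
    have h1 : ∀ x, (f x - t * g x) ^ 2 = f x ^ 2 - 2 * t * (f x * g x) + t ^ 2 * g x ^ 2 :=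
      fun x => by ring
    simp_rw [h1]
    have h2 : Integrable (fun x => 2 * t * (f x * g x)) μ := hfg.const_mul _
    have h3 : Integrable (fun x => t ^ 2 * g x ^ 2) μ := hgg.const_mul _
    have h4 : Integrable (fun x => f x ^ 2 - 2 * t * (f x * g x)) μ := hff.sub h2
    rw [integral_add h4 h3, integral_sub hff h2, integral_const_mul, integral_const_mul]
  set A := ∫ x, f x ^ 2 ∂μ
  set B := ∫ x, g x ^ 2 ∂μ
  set M := ∫ x, f x * g x ∂μ
  have hA : 0 ≤ A := integral_nonneg fun x => sq_nonneg _
  have hB : 0 ≤ B := integral_nonneg fun x => sq_nonneg _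
  -- Cauchy–Schwarz, from the nonnegativity of the quadratic `t ↦ ∫ (f - t g)²`.
  have hd : discrim B (-2 * M) A ≤ 0 := by
    refine discrim_le_zero fun t => ?_
    have h0 : 0 ≤ ∫ x, (f x - t * g x) ^ 2 ∂μ := integral_nonneg fun x => sq_nonneg _
    rw [hexp] at h0
    linarith
  have hM : M ≤ √A * √B := by
    rw [← Real.sqrt_mul hA]
    refine Real.le_sqrt_of_sq_le ?_
    unfold discrim at hd
    linarith
  have h1 := hexp 1
  simp only [one_mul] at h1
  rw [h1, sub_sq, Real.sq_sqrt hA, Real.sq_sqrt hB]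
  linarith

/-- Reverse triangle inequality in the plane for the vectors `(√p, √e)` and `(√q, √e)`. It lets a
square root be smoothed by adding `e` under it without increasing any difference, hence without
increasing the energy. -/
theorem sq_sqrt_add_sub_sqrt_add_le {p q e : ℝ} (hp : 0 ≤ p) (hq : 0 ≤ q) (he : 0 ≤ e) :
    (√(p + e) - √(q + e)) ^ 2 ≤ (√p - √q) ^ 2 := by
  have h1 : √p * √q + e ≤ √(p + e) * √(q + e) := by
    rw [← Real.sqrt_mul hp, ← Real.sqrt_mul (add_nonneg hp he)]
    refine Real.le_sqrt_of_sq_le ?_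
    have h2 : 2 * √(p * q) ≤ p + q := by
      rw [Real.sqrt_mul hp]
      nlinarith [sq_nonneg (√p - √q), Real.sq_sqrt hp, Real.sq_sqrt hq]
    nlinarith [Real.sq_sqrt (mul_nonneg hp hq)]
  rw [sub_sq, sub_sq, Real.sq_sqrt hp, Real.sq_sqrt hq, Real.sq_sqrt (by positivity),
    Real.sq_sqrt (by positivity)]
  linarith

/-! ### From the strip to the interval: norms of slices -/

section

variable {d : ℕ} {s : ℝ}

theorem measurable_gagliardo_integrand {u : EuclideanSpace ℝ (Fin d) → ℝ} (hu : Measurable u)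
    (p : ℝ) : Measurable (fun z : EuclideanSpace ℝ (Fin d) × EuclideanSpace ℝ (Fin d) =>
      ENNReal.ofReal (|u z.1 - u z.2| ^ 2 / ‖z.1 - z.2‖ ^ p)) := by
  fun_prop

theorem measurable_snocPoint :
    Measurable fun p : EuclideanSpace ℝ (Fin d) × ℝ => snocPoint p.1 p.2 :=
  continuous_snocPoint.measurable

theorem lintegral_strip_strip
    {F : EuclideanSpace ℝ (Fin (d + 1)) × EuclideanSpace ℝ (Fin (d + 1)) → ℝ≥0∞}
    (hF : Measurable F) :
    ∫⁻ z in strip d, ∫⁻ w in strip d, F (z, w) =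
      ∫⁻ a in Set.Ioo (-1 : ℝ) 1, ∫⁻ b in Set.Ioo (-1 : ℝ) 1,
        ∫⁻ x : EuclideanSpace ℝ (Fin d), ∫⁻ y : EuclideanSpace ℝ (Fin d),
          F (snocPoint x a, snocPoint y b) := by
  rw [setLIntegral_strip hF.lintegral_prod_right']
  refine lintegral_congr fun a => ?_
  have h1 : ∀ x : EuclideanSpace ℝ (Fin d), ∫⁻ w in strip d, F (snocPoint x a, w) =
      ∫⁻ b in Set.Ioo (-1 : ℝ) 1, ∫⁻ y : EuclideanSpace ℝ (Fin d),
        F (snocPoint x a, snocPoint y b) :=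
    fun x => setLIntegral_strip (hF.comp measurable_prodMk_left)
  simp_rw [h1]
  refine lintegral_lintegral_swap (Measurable.aemeasurable ?_)
  refine Measurable.lintegral_prod_right' (f := fun q : (EuclideanSpace ℝ (Fin d) × ℝ) ×
    EuclideanSpace ℝ (Fin d) => F (snocPoint q.1.1 a, snocPoint q.2 q.1.2)) ?_
  refine hF.comp ?_
  exact (measurable_snocPoint.comp (measurable_fst.fst.prodMk measurable_const)).prodMk
    (measurable_snocPoint.comp (measurable_snd.prodMk measurable_fst.snd))

/-- The Gagliardo energy on the strip, with the variables of the cross-section outermost. -/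
theorem gagliardoSq_strip {u : EuclideanSpace ℝ (Fin (d + 1)) → ℝ} (hu : Measurable u) :
    gagliardoSq (d + 1) s (strip d) u = ENNReal.ofReal (fracConst (d + 1) s / 2) *
      ∫⁻ a in Set.Ioo (-1 : ℝ) 1, ∫⁻ b in Set.Ioo (-1 : ℝ) 1,
        ∫⁻ z : EuclideanSpace ℝ (Fin d), ∫⁻ x : EuclideanSpace ℝ (Fin d),
          ENNReal.ofReal (1 / (‖z‖ ^ 2 + (a - b) ^ 2) ^ (((d + 1 : ℕ) + 2 * s) / 2)) *
          ENNReal.ofReal ((u (snocPoint x a) - u (snocPoint (x + z) b)) ^ 2) := by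
  have hF := measurable_gagliardo_integrand hu ((d + 1 : ℕ) + 2 * s)
  have h0 := lintegral_strip_strip hF
  dsimp only at h0
  unfold gagliardoSq
  rw [h0]
  congr 1
  refine lintegral_congr fun a => lintegral_congr fun b => ?_
  symm
  rw [lintegral_lintegral_swap]
  · refine lintegral_congr fun x => ?_
    symm
    rw [← lintegral_add_left_eq_self _ x]
    refine lintegral_congr fun z => ?_
    rw [← ENNReal.ofReal_mul (by positivity), norm_snocPoint_sub_rpow, sq_abs,
      sub_add_cancel_left, norm_neg, div_eq_mul_one_div, mul_comm]
  · refine Measurable.aemeasurable ?_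
    have h2 : Measurable fun p : EuclideanSpace ℝ (Fin d) × EuclideanSpace ℝ (Fin d) =>
      u (snocPoint p.2 a) :=
      hu.comp (measurable_snocPoint.comp (measurable_snd.prodMk measurable_const))
    have h3 : Measurable fun p : EuclideanSpace ℝ (Fin d) × EuclideanSpace ℝ (Fin d) =>
      u (snocPoint (p.2 + p.1) b) :=
      hu.comp (measurable_snocPoint.comp
        ((measurable_snd.add measurable_fst).prodMk measurable_const))
    have h4 : Measurable fun p : EuclideanSpace ℝ (Fin d) × EuclideanSpace ℝ (Fin d) =>
        1 / (‖p.1‖ ^ 2 + (a - b) ^ 2) ^ (((d + 1 : ℕ) + 2 * s) / 2) := by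
      fun_prop
    exact h4.ennreal_ofReal.mul ((h2.sub h3).pow_const 2).ennreal_ofReal

theorem l2Sq_strip {u : EuclideanSpace ℝ (Fin (d + 1)) → ℝ} (hu : Measurable u) :
    l2Sq (d + 1) (strip d) u = ∫⁻ a in Set.Ioo (-1 : ℝ) 1, ∫⁻ x : EuclideanSpace ℝ (Fin d),
      ENNReal.ofReal (u (snocPoint x a) ^ 2) :=
  setLIntegral_strip (by fun_prop)

/-- The first `d` coordinates of a point of `ℝ^(d+1)`. -/
noncomputable def initPoint (z : EuclideanSpace ℝ (Fin (d + 1))) : EuclideanSpace ℝ (Fin d) :=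
  WithLp.toLp 2 fun i => z i.castSucc

@[simp] theorem initPoint_apply (z : EuclideanSpace ℝ (Fin (d + 1))) (i : Fin d) :
    initPoint z i = z i.castSucc := rfl

@[simp] theorem initPoint_snocPoint (x : EuclideanSpace ℝ (Fin d)) (t : ℝ) :
    initPoint (snocPoint x t) = x := by
  ext i
  simp

theorem contDiff_initPoint : ContDiff ℝ ∞ (initPoint (d := d)) := by
  rw [contDiff_euclidean]
  intro i
  simp only [initPoint_apply]
  fun_prop

theorem hasCompactSupport_slice {u : EuclideanSpace ℝ (Fin (d + 1)) → ℝ}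
    (hu : HasCompactSupport u) (a : ℝ) : HasCompactSupport fun x => u (snocPoint x a) := by
  refine HasCompactSupport.intro (hu.isCompact.image contDiff_initPoint.continuous)
    fun x hx => ?_
  by_contra h
  exact hx ⟨snocPoint x a, subset_tsupport _ h, initPoint_snocPoint x a⟩

theorem continuous_slice {u : EuclideanSpace ℝ (Fin (d + 1)) → ℝ}
    (hu : Continuous u) (a : ℝ) : Continuous fun x => u (snocPoint x a) :=
  hu.comp (continuous_snocPoint.comp (continuous_id.prodMk continuous_const))

theorem memLp_slice {u : EuclideanSpace ℝ (Fin (d + 1)) → ℝ} (hu : Continuous u)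
    (hc : HasCompactSupport u) (a : ℝ) : MemLp (fun x => u (snocPoint x a)) 2 volume :=
  (continuous_slice hu a).memLp_of_hasCompactSupport (hasCompactSupport_slice hc a)

/-- The squared `L²` norms of the slices of a function on `ℝ^(d+1)`. -/
noncomputable def sliceSq (u : EuclideanSpace ℝ (Fin (d + 1)) → ℝ) (a : ℝ) : ℝ :=
  ∫ x : EuclideanSpace ℝ (Fin d), u (snocPoint x a) ^ 2

theorem sliceSq_nonneg (u : EuclideanSpace ℝ (Fin (d + 1)) → ℝ) (a : ℝ) : 0 ≤ sliceSq u a :=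
  integral_nonneg fun _ => sq_nonneg _

theorem ofReal_sliceSq {u : EuclideanSpace ℝ (Fin (d + 1)) → ℝ} (hu : Continuous u)
    (hc : HasCompactSupport u) (a : ℝ) :
    ENNReal.ofReal (sliceSq u a) =
      ∫⁻ x : EuclideanSpace ℝ (Fin d), ENNReal.ofReal (u (snocPoint x a) ^ 2) :=
  ofReal_integral_eq_lintegral_ofReal (memLp_slice hu hc a).integrable_sq
    (Filter.Eventually.of_forall fun _ => sq_nonneg _)

/-- Differentiation under the integral sign, obtained by reading the slice integral as a convolution
with the constant `1`, depending on the parameter `a` and evaluated at `0`. All slices vanish off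
the compact projection of the support of `u`. -/
theorem contDiff_sliceSq {u : EuclideanSpace ℝ (Fin (d + 1)) → ℝ} (hu : ContDiff ℝ ∞ u)
    (hc : HasCompactSupport u) : ContDiff ℝ ∞ (sliceSq u) := by
  have h := contDiffOn_convolution_right_with_param (𝕜 := ℝ) (n := ⊤)
    (μ := (volume : Measure (EuclideanSpace ℝ (Fin d)))) (f := fun _ => (1 : ℝ))
    (ContinuousLinearMap.mul ℝ ℝ) (s := (Set.univ : Set ℝ))
    (g := fun a x => u (snocPoint x a) ^ 2)
    (k := initPoint '' tsupport u) isOpen_univ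
    (hc.isCompact.image contDiff_initPoint.continuous) (fun a x _ hx => by
      have : u (snocPoint x a) = 0 := by
        by_contra h
        exact hx ⟨snocPoint x a, subset_tsupport _ h, initPoint_snocPoint x a⟩
      simp [this]) (locallyIntegrable_const _) (by
      refine ContDiff.contDiffOn ?_
      exact (hu.comp (contDiff_snocPoint.comp (contDiff_snd.prodMk contDiff_fst))).pow 2)
  rw [Set.univ_prod_univ, contDiffOn_univ] at h
  have h2 : ContDiff ℝ ∞ fun a : ℝ => (a, (0 : EuclideanSpace ℝ (Fin d))) :=
    contDiff_id.prodMk contDiff_const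
  convert h.comp h2 using 1
  ext a
  simp only [Function.comp, convolution_def, ContinuousLinearMap.mul_apply', one_mul, zero_sub]
  exact (integral_neg_eq_self (fun x => u (snocPoint x a) ^ 2) volume).symm

/-- Fix the horizontal shift `z`. Translating a slice does not change its norm, so `(‖u(·,a)‖ -
‖u(·,b)‖)²` is at most `∫ (u(x,a) - u(x+z,b))² dx`. The left side is independent of `z`; integrating
against the kernel in `z` leaves the one-dimensional kernel. -/
theorem lineEnergy_sqrt_sliceSq_le (hs : 0 < s) (hs1 : s < 1)
    {u : EuclideanSpace ℝ (Fin (d + 1)) → ℝ} (hu : Continuous u) (hc : HasCompactSupport u) :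
    ENNReal.ofReal (fracConst 1 s / 2) * lineEnergy s (fun a => √(sliceSq u a)) ≤
      gagliardoSq (d + 1) s (strip d) u := by
  rw [gagliardoSq_strip hu.measurable, lineEnergy, ← lintegral_const_mul' _ _
    ENNReal.ofReal_ne_top, ← lintegral_const_mul' _ _ ENNReal.ofReal_ne_top]
  refine lintegral_mono fun a => ?_
  dsimp only
  rw [← lintegral_const_mul' _ _ ENNReal.ofReal_ne_top, ← lintegral_const_mul' _ _
    ENNReal.ofReal_ne_top]
  refine lintegral_mono fun b => ?_
  dsimp only
  -- On the diagonal the left side is `0`; the marginal identity for the kernel needs `a ≠ b`.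
  by_cases hab : a = b
  · simp [hab]
  have h1 : ∀ z : EuclideanSpace ℝ (Fin d),
      ENNReal.ofReal ((√(sliceSq u a) - √(sliceSq u b)) ^ 2) ≤
      ∫⁻ x, ENNReal.ofReal ((u (snocPoint x a) - u (snocPoint (x + z) b)) ^ 2) := by
    intro z
    have hf := memLp_slice hu hc a
    have hg : MemLp (fun x => u (snocPoint (x + z) b)) 2 volume :=
      (memLp_slice hu hc b).comp_measurePreserving (measurePreserving_add_right volume z)
    have hgz : sliceSq u b = ∫ x : EuclideanSpace ℝ (Fin d), u (snocPoint (x + z) b) ^ 2 :=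
      (integral_add_right_eq_self (fun x => u (snocPoint x b) ^ 2) z).symm
    have hi : Integrable (fun x => (u (snocPoint x a) - u (snocPoint (x + z) b)) ^ 2) volume :=
      (hf.sub hg).integrable_sq
    rw [← ofReal_integral_eq_lintegral_ofReal hi
      (Filter.Eventually.of_forall fun _ => sq_nonneg _), hgz]
    exact ENNReal.ofReal_le_ofReal (sq_sqrt_integral_sub_le hf hg)
  calc _ = ENNReal.ofReal ((√(sliceSq u a) - √(sliceSq u b)) ^ 2) *
        (ENNReal.ofReal (fracConst 1 s / 2) * ENNReal.ofReal (1 / |a - b| ^ (1 + 2 * s))) := by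
        rw [div_eq_mul_one_div ((√(sliceSq u a) - √(sliceSq u b)) ^ 2),
          ENNReal.ofReal_mul (sq_nonneg _)]
        ring
    _ = ENNReal.ofReal (fracConst (d + 1) s / 2) *
        (ENNReal.ofReal ((√(sliceSq u a) - √(sliceSq u b)) ^ 2) *
        ∫⁻ z : EuclideanSpace ℝ (Fin d), ENNReal.ofReal
          (1 / (‖z‖ ^ 2 + (a - b) ^ 2) ^ (((d + 1 : ℕ) + 2 * s) / 2))) := by
        rw [← fracConst_mul_lintegral_kernel d hs hs1 (sub_ne_zero.2 hab)]
        ring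
    _ ≤ _ := by
        gcongr
        rw [← lintegral_const_mul' _ _ ENNReal.ofReal_ne_top]
        refine lintegral_mono fun z => ?_
        dsimp only
        rw [lintegral_const_mul' _ _ ENNReal.ofReal_ne_top, mul_comm]
        gcongr
        exact h1 z

theorem lineEnergy_mono {v w : ℝ → ℝ} (h : ∀ a b, (v a - v b) ^ 2 ≤ (w a - w b) ^ 2) :
    lineEnergy s v ≤ lineEnergy s w := by
  refine lintegral_mono fun a => lintegral_mono fun b => ENNReal.ofReal_le_ofReal ?_
  exact div_le_div_of_nonneg_right (h a b) (by positivity)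

/-- The slice norm itself need not be smooth where it vanishes. Adding `e` under the root repairs
this, and subtracting `√e` restores compact support. -/
theorem isLineTest_sqrt_sliceSq_add {u : EuclideanSpace ℝ (Fin (d + 1)) → ℝ}
    (hu : IsTestFunction (d + 1) (strip d) u) {e : ℝ} (he : 0 < e) :
    IsLineTest fun a => √(sliceSq u a + e) - √e := by
  have hlast : Continuous fun z : EuclideanSpace ℝ (Fin (d + 1)) => z (Fin.last d) := by fun_prop
  have hT := hu.2.1.isCompact.image hlast
  have hsupp : Function.support (fun a => √(sliceSq u a + e) - √e) ⊆
      (fun z : EuclideanSpace ℝ (Fin (d + 1)) => z (Fin.last d)) '' tsupport u := by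
    intro a ha
    by_contra hcon
    refine ha ?_
    have h0 : sliceSq u a = 0 := by
      unfold sliceSq
      rw [← integral_zero (EuclideanSpace ℝ (Fin d)) ℝ]
      congr 1
      ext x
      have : u (snocPoint x a) = 0 := by
        by_contra h
        exact hcon ⟨snocPoint x a, subset_tsupport _ h, snocPoint_last x a⟩
      simp [this]
    simp [h0]
  have hts : tsupport (fun a => √(sliceSq u a + e) - √e) ⊆ _ :=
    closure_minimal hsupp hT.isClosed
  refine ⟨?_, HasCompactSupport.of_support_subset_isCompact hT hsupp, hts.trans ?_⟩
  · refine ContDiff.sub (ContDiff.sqrt ?_ fun a => ?_) contDiff_const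
    · exact (contDiff_sliceSq hu.1 hu.2.1).add contDiff_const
    · exact (add_pos_of_nonneg_of_pos (sliceSq_nonneg u a) he).ne'
  · rintro _ ⟨z, hz, rfl⟩
    exact hu.2.2 hz

-- Apply the interval inequality to the smoothed slice norms with `e = 1/(k+1)`. Their energies are
-- bounded by that of `u` for every `k`, and Fatou's lemma recovers the full `L²` mass of `u` as `k
-- → ∞`.
open Filter Topology in
theorem le_regionalPoincare_strip_of_interval (hs : 0 < s) (hs1 : s < 1) {c : ℝ≥0∞} (hc : c ≠ ⊤)
    (h : c ≤ regionalPoincare 1 s interval11) :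
    c ≤ regionalPoincare (d + 1) s (strip d) := by
  rw [le_regionalPoincare_interval11_iff hs hs1 hc] at h
  rw [le_regionalPoincare_iff hs hs1 hc]
  intro u hu
  have hcont := hu.continuous
  set v : ℕ → ℝ → ℝ := fun k a => √(sliceSq u a + 1 / ((k : ℝ) + 1)) - √(1 / ((k : ℝ) + 1))
    with hv
  have h1 : ∀ k, c * lineL2 (v k) ≤ gagliardoSq (d + 1) s (strip d) u := by
    intro k
    have hk : (0 : ℝ) < 1 / ((k : ℝ) + 1) := by positivity
    refine (h _ (isLineTest_sqrt_sliceSq_add hu hk)).trans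
      (le_trans ?_ (lineEnergy_sqrt_sliceSq_le hs hs1 hcont hu.2.1))
    gcongr
    refine lineEnergy_mono fun a b => ?_
    rw [sub_sub_sub_cancel_right]
    exact sq_sqrt_add_sub_sqrt_add_le (sliceSq_nonneg u a) (sliceSq_nonneg u b) hk.le
  have hlim : ∀ a, Tendsto (fun k => ENNReal.ofReal (v k a ^ 2)) atTop
      (𝓝 (ENNReal.ofReal (sliceSq u a))) := by
    intro a
    have h0 : Tendsto (fun k : ℕ => 1 / ((k : ℝ) + 1)) atTop (𝓝 0) :=
      tendsto_one_div_add_atTop_nhds_zero_nat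
    have h2 : Continuous fun e : ℝ => (√(sliceSq u a + e) - √e) ^ 2 := by fun_prop
    have h3 := (h2.tendsto 0).comp h0
    simp only [add_zero, Real.sqrt_zero, sub_zero, Real.sq_sqrt (sliceSq_nonneg u a)] at h3
    exact (ENNReal.continuous_ofReal.tendsto _).comp h3
  have hmeas : ∀ k, Measurable fun a => ENNReal.ofReal (v k a ^ 2) := by
    intro k
    have := (isLineTest_sqrt_sliceSq_add hu (e := 1 / ((k : ℝ) + 1)) (by positivity)).1.continuous
    exact ENNReal.measurable_ofReal.comp (this.pow 2).measurable
  have hl2 : l2Sq (d + 1) (strip d) u =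
      ∫⁻ a in Set.Ioo (-1 : ℝ) 1, liminf (fun k => ENNReal.ofReal (v k a ^ 2)) atTop := by
    rw [l2Sq_strip hcont.measurable]
    refine lintegral_congr fun a => ?_
    rw [(hlim a).liminf_eq, ofReal_sliceSq hcont hu.2.1]
  rw [hl2]
  calc _ ≤ c * liminf (fun k => lineL2 (v k)) atTop := by
        gcongr
        exact lintegral_liminf_le hmeas
    _ = liminf (fun k => c * lineL2 (v k)) atTop := (ENNReal.liminf_const_mul_of_ne_top hc).symm
    _ ≤ gagliardoSq (d + 1) s (strip d) u := liminf_le_of_le ⟨0, by simp⟩ (fun b hb => by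
        obtain ⟨k, hk⟩ := hb.exists
        exact hk.trans (h1 k))

end

/-! ### From the interval to the strip: products with wide cutoffs -/

section

variable {d : ℕ} {s : ℝ}

/-- In polar coordinates the integrand is `r^(1-2s)` near the origin, integrable since `s < 1`, and
`r^(-1-2s)` at infinity, integrable since `s > 0`. -/
theorem lintegral_min_one_sq_div_lt_top (d : ℕ) {s : ℝ} (hs : 0 < s) (hs1 : s < 1) :
    ∫⁻ z : EuclideanSpace ℝ (Fin (d + 1)),
      ENNReal.ofReal (min 1 (‖z‖ ^ 2) / ‖z‖ ^ (((d + 1 : ℕ) : ℝ) + 2 * s)) < ⊤ := by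
  have h1 : IntegrableOn (fun y : ℝ => y ^ d •
      (min 1 (y ^ 2) / y ^ (((d + 1 : ℕ) : ℝ) + 2 * s))) (Set.Ioi 0) := by
    rw [← Set.Ioc_union_Ioi_eq_Ioi zero_le_one, integrableOn_union]
    constructor
    · have h2 : IntegrableOn (fun y : ℝ => y ^ (1 - 2 * s)) (Set.Ioc 0 1) := by
        rw [← intervalIntegrable_iff_integrableOn_Ioc_of_le zero_le_one]
        exact intervalIntegral.intervalIntegrable_rpow' (by linarith)
      refine h2.congr_fun (fun y hy => ?_) measurableSet_Ioc
      have hy0 : 0 < y := hy.1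
      have : min 1 (y ^ 2) = y ^ 2 := min_eq_right (pow_le_one₀ hy0.le hy.2)
      simp only [this, smul_eq_mul]
      rw [← Real.rpow_natCast, ← Real.rpow_natCast, ← Real.rpow_sub hy0, ← Real.rpow_add hy0]
      congr 1
      push_cast
      ring
    · have h2 : IntegrableOn (fun y : ℝ => y ^ (-1 - 2 * s)) (Set.Ioi 1) :=
        integrableOn_Ioi_rpow_of_lt (by linarith) one_pos
      refine h2.congr_fun (fun y hy => ?_) measurableSet_Ioi
      have hy1 : 1 < y := hy
      have hy0 : 0 < y := one_pos.trans hy1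
      have : min 1 (y ^ 2) = 1 := min_eq_left (one_le_pow₀ hy1.le)
      simp only [this, smul_eq_mul]
      rw [one_div, ← Real.rpow_neg hy0.le, ← Real.rpow_natCast, ← Real.rpow_add hy0]
      congr 1
      push_cast
      ring
  have h3 : Integrable (fun z : EuclideanSpace ℝ (Fin (d + 1)) =>
      min 1 (‖z‖ ^ 2) / ‖z‖ ^ (((d + 1 : ℕ) : ℝ) + 2 * s)) := by
    refine (integrable_fun_norm_addHaar volume
      (f := fun y : ℝ => min 1 (y ^ 2) / y ^ (((d + 1 : ℕ) : ℝ) + 2 * s))).2 ?_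
    simpa using h1
  exact h3.lintegral_lt_top

open Filter Topology in
theorem tendsto_lintegral_min_one_sq_div (d : ℕ) {s : ℝ} (hs : 0 < s) (hs1 : s < 1) :
    Tendsto (fun k : ℕ => ∫⁻ z : EuclideanSpace ℝ (Fin (d + 1)),
      ENNReal.ofReal (min 1 ((1 / ((k : ℝ) + 1)) ^ 2 * ‖z‖ ^ 2) /
        ‖z‖ ^ (((d + 1 : ℕ) : ℝ) + 2 * s))) atTop (𝓝 0) := by
  have h := tendsto_lintegral_of_dominated_convergence (μ := volume)
    (F := fun (k : ℕ) (z : EuclideanSpace ℝ (Fin (d + 1))) =>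
      ENNReal.ofReal (min 1 ((1 / ((k : ℝ) + 1)) ^ 2 * ‖z‖ ^ 2) /
        ‖z‖ ^ (((d + 1 : ℕ) : ℝ) + 2 * s))) (f := fun _ => 0)
    (fun z => ENNReal.ofReal (min 1 (‖z‖ ^ 2) / ‖z‖ ^ (((d + 1 : ℕ) : ℝ) + 2 * s)))
    (fun k => by fun_prop) (fun k => Eventually.of_forall fun z => ?_)
    (lintegral_min_one_sq_div_lt_top d hs hs1).ne (Eventually.of_forall fun z => ?_)
  · simpa using h
  · have h1 : (1 / ((k : ℝ) + 1)) ^ 2 ≤ 1 := by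
      refine pow_le_one₀ (by positivity) ?_
      rw [div_le_one (by positivity)]
      linarith [k.cast_nonneg (α := ℝ)]
    have h2 : (1 / ((k : ℝ) + 1)) ^ 2 * ‖z‖ ^ 2 ≤ ‖z‖ ^ 2 :=
      mul_le_of_le_one_left (sq_nonneg _) h1
    dsimp only
    gcongr
  · have h0 : Tendsto (fun k : ℕ => 1 / ((k : ℝ) + 1)) atTop (𝓝 0) :=
      tendsto_one_div_add_atTop_nhds_zero_nat
    have h2 : Continuous fun e : ℝ => ENNReal.ofReal (min 1 (e ^ 2 * ‖z‖ ^ 2) /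
        ‖z‖ ^ (((d + 1 : ℕ) : ℝ) + 2 * s)) := by
      refine ENNReal.continuous_ofReal.comp ?_
      exact (continuous_const.min (by fun_prop)).div_const _
    simpa [Function.comp_def] using (h2.tendsto 0).comp h0

/-- Cutoff functions on `ℝ^d` whose translation differences are small relative to their norm. -/
theorem exists_cutoff (d : ℕ) {M : ℝ} (hM : 0 < M) :
    ∃ η : EuclideanSpace ℝ (Fin d) → ℝ, ContDiff ℝ ∞ η ∧ HasCompactSupport η ∧
      (∫⁻ x, ENNReal.ofReal (η x ^ 2)) ≠ 0 ∧ (∫⁻ x, ENNReal.ofReal (η x ^ 2)) ≠ ⊤ ∧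
      ∀ z, ∫⁻ x, ENNReal.ofReal ((η x - η (x + z)) ^ 2) ≤
        ENNReal.ofReal (min 1 (M ^ 2 * ‖z‖ ^ 2)) *
          (2 ^ (d + 1) * ∫⁻ x, ENNReal.ofReal (η x ^ 2)) := by
  let β : ContDiffBump (0 : EuclideanSpace ℝ (Fin d)) := ⟨1, 2, one_pos, one_lt_two⟩
  obtain ⟨L, hL⟩ := ContDiff.lipschitzWith_of_hasCompactSupport (𝕂 := ℝ) (n := 1)
    β.hasCompactSupport β.contDiff one_ne_zero
  -- Dilating the bump by `R` divides its Lipschitz constant `L` by `R`; this choice makes the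
  -- result at most `M`, and the `+ 1` keeps `R` positive.
  set R : ℝ := (L + 1) / M with hR
  have hR0 : 0 < R := by positivity
  set η : EuclideanSpace ℝ (Fin d) → ℝ := fun x => β (R⁻¹ • x) with hη
  have hnorm : ∀ x : EuclideanSpace ℝ (Fin d), ‖R⁻¹ • x‖ = ‖x‖ / R := fun x => by
    rw [norm_smul, norm_inv, Real.norm_of_nonneg hR0.le, inv_mul_eq_div]
  have hηc : ContDiff ℝ ∞ η := β.contDiff.comp (contDiff_id.const_smul _)
  have hη0 : ∀ x, x ∉ Metric.ball (0 : EuclideanSpace ℝ (Fin d)) (2 * R) → η x = 0 := by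
    intro x hx
    refine β.zero_of_le_dist ?_
    rw [dist_zero_right, hnorm, le_div_iff₀ hR0]
    simpa using hx
  have hη1 : ∀ x ∈ Metric.ball (0 : EuclideanSpace ℝ (Fin d)) R, η x = 1 := by
    intro x hx
    refine β.one_of_mem_closedBall ?_
    rw [mem_closedBall_zero_iff, hnorm, div_le_iff₀ hR0]
    exact (mem_ball_zero_iff.1 hx).le.trans_eq (one_mul R).symm
  have hηs : HasCompactSupport η := by
    refine HasCompactSupport.intro
      (isCompact_closedBall (0 : EuclideanSpace ℝ (Fin d)) (2 * R)) fun x hx => hη0 x ?_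
    exact fun h => hx (Metric.ball_subset_closedBall h)
  have hdiff : ∀ x y, (η x - η y) ^ 2 ≤ min 1 (M ^ 2 * ‖y - x‖ ^ 2) := by
    intro x y
    refine le_min ?_ ?_
    · rw [sq_le_one_iff_abs_le_one, abs_le]
      have h1 := β.nonneg (x := R⁻¹ • x)
      have h2 := β.le_one (x := R⁻¹ • x)
      have h3 := β.nonneg (x := R⁻¹ • y)
      have h4 := β.le_one (x := R⁻¹ • y)
      constructor <;> simp only [hη] <;> linarith
    · rw [← mul_pow, ← sq_abs]
      gcongr
      have h1 := hL.dist_le_mul (R⁻¹ • x) (R⁻¹ • y)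
      rw [Real.dist_eq, dist_eq_norm, ← smul_sub, hnorm, norm_sub_rev] at h1
      refine h1.trans ?_
      rw [mul_div_assoc', div_le_iff₀ hR0]
      have h2 : M * R = L + 1 := by rw [hR]; field_simp
      calc (L : ℝ) * ‖y - x‖ ≤ (L + 1) * ‖y - x‖ := by gcongr; linarith
        _ = M * ‖y - x‖ * R := by rw [← h2]; ring
  have hA : volume (Metric.ball (0 : EuclideanSpace ℝ (Fin d)) R) ≤
      ∫⁻ x, ENNReal.ofReal (η x ^ 2) := by
    rw [← lintegral_indicator_one measurableSet_ball]
    refine lintegral_mono fun x => ?_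
    by_cases hx : x ∈ Metric.ball (0 : EuclideanSpace ℝ (Fin d)) R
    · simp [Set.indicator_of_mem hx, hη1 x hx]
    · simp [Set.indicator_of_notMem hx]
  refine ⟨η, hηc, hηs, ?_, ?_, fun z => ?_⟩
  · exact ((Metric.measure_ball_pos volume _ hR0).trans_le hA).ne'
  · have h1 : MemLp η 2 (volume : Measure (EuclideanSpace ℝ (Fin d))) :=
      hηc.continuous.memLp_of_hasCompactSupport hηs
    have h2 := h1.integrable_sq.lintegral_lt_top
    exact h2.ne
  · set B := Metric.ball (0 : EuclideanSpace ℝ (Fin d)) (2 * R) with hB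
    have hBm : MeasurableSet B := measurableSet_ball
    have hI : Measurable (B.indicator (1 : EuclideanSpace ℝ (Fin d) → ℝ≥0∞)) :=
      measurable_one.indicator hBm
    -- Origin of the factor `2^(d+1)`: a difference can be nonzero only if `x` or `x + z` lies in
    -- the ball of radius `2R`, which gives two such balls, each `2^d` times the ball of radius `R`
    -- on which `η = 1`.
    have hvol : volume B = 2 ^ d * volume (Metric.ball (0 : EuclideanSpace ℝ (Fin d)) R) := by
      rw [hB, Measure.addHaar_ball_mul_of_pos volume _ two_pos]
      simp [ENNReal.ofReal_pow]
    calc _ ≤ ∫⁻ x, ENNReal.ofReal (min 1 (M ^ 2 * ‖z‖ ^ 2)) *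
          (B.indicator 1 x + B.indicator 1 (x + z)) := by
          refine lintegral_mono fun x => ?_
          have h1 := hdiff x (x + z)
          rw [add_sub_cancel_left] at h1
          have h2 := ENNReal.ofReal_le_ofReal h1
          by_cases hx : x ∈ B
          · refine h2.trans (le_mul_of_one_le_right zero_le ?_)
            simp [Set.indicator_of_mem hx]
          by_cases hxz : x + z ∈ B
          · refine h2.trans (le_mul_of_one_le_right zero_le ?_)
            simp [Set.indicator_of_mem hxz]
          · simp [hη0 x hx, hη0 _ hxz]
      _ = ENNReal.ofReal (min 1 (M ^ 2 * ‖z‖ ^ 2)) * (volume B + volume B) := by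
          rw [lintegral_const_mul' _ _ ENNReal.ofReal_ne_top, lintegral_add_left hI,
            lintegral_add_right_eq_self (B.indicator (1 : EuclideanSpace ℝ (Fin d) → ℝ≥0∞)) z,
            lintegral_indicator_one hBm]
      _ ≤ _ := by
          rw [hvol, ← two_mul, ← mul_assoc 2, ← pow_succ']
          gcongr

@[simp] theorem snocPoint_initPoint (z : EuclideanSpace ℝ (Fin (d + 1))) :
    snocPoint (initPoint z) (z (Fin.last d)) = z := by
  ext i
  refine Fin.lastCases ?_ (fun j => ?_) i <;> simp

theorem isTestFunction_strip_mul {η : EuclideanSpace ℝ (Fin d) → ℝ} {v : ℝ → ℝ}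
    (hη : ContDiff ℝ ∞ η) (hηs : HasCompactSupport η) (hv : IsLineTest v) :
    IsTestFunction (d + 1) (strip d) fun z => η (initPoint z) * v (z (Fin.last d)) := by
  have hK := (hηs.isCompact.prod hv.2.1.isCompact).image
    (continuous_snocPoint (d := d))
  have hsupp : Function.support (fun z : EuclideanSpace ℝ (Fin (d + 1)) =>
      η (initPoint z) * v (z (Fin.last d))) ⊆
      (fun p : EuclideanSpace ℝ (Fin d) × ℝ => snocPoint p.1 p.2) ''
        (tsupport η ×ˢ tsupport v) := by
    intro z hz
    have h1 := left_ne_zero_of_mul hz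
    have h2 := right_ne_zero_of_mul hz
    exact ⟨(initPoint z, z (Fin.last d)), ⟨subset_tsupport _ h1, subset_tsupport _ h2⟩,
      snocPoint_initPoint z⟩
  refine ⟨?_, HasCompactSupport.of_support_subset_isCompact hK hsupp,
    (closure_minimal hsupp hK.isClosed).trans ?_⟩
  · exact (hη.comp contDiff_initPoint).mul (hv.1.comp (by fun_prop))
  · rintro _ ⟨p, hp, rfl⟩
    have := hv.2.2 hp.2
    simpa [strip] using this

theorem lintegral_lintegral_snocPoint_sub {F : EuclideanSpace ℝ (Fin (d + 1)) → ℝ≥0∞}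
    (hF : Measurable F) (b : ℝ) :
    ∫⁻ a, ∫⁻ z, F (snocPoint z (a - b)) = ∫⁻ w, F w := by
  rw [lintegral_eq_lintegral_snocPoint hF]
  exact lintegral_sub_right_eq_self (fun t => ∫⁻ z, F (snocPoint z t)) b

/-- Split `η(x) v(a) - η(x+z) v(b)` as `η(x) (v(a) - v(b)) + v(b) (η(x) - η(x+z))`. The first part
carries weight `1 + δ` and, after the kernel is integrated in `z`, gives the energy of `v`; the
second is controlled by the slow variation of `η`. -/
theorem gagliardoSq_strip_mul_le (hs : 0 < s) (hs1 : s < 1) {η : EuclideanSpace ℝ (Fin d) → ℝ}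
    (hη : Continuous η) {v : ℝ → ℝ} (hv : Continuous v) {M : ℝ} {A : ℝ≥0∞}
    (hA : ∀ z, ∫⁻ x, ENNReal.ofReal ((η x - η (x + z)) ^ 2) ≤
        ENNReal.ofReal (min 1 (M ^ 2 * ‖z‖ ^ 2)) * A) {δ : ℝ} (hδ : 0 < δ) :
    gagliardoSq (d + 1) s (strip d) (fun z => η (initPoint z) * v (z (Fin.last d))) ≤
      ENNReal.ofReal (1 + δ) * ((∫⁻ x, ENNReal.ofReal (η x ^ 2)) *
        (ENNReal.ofReal (fracConst 1 s / 2) * lineEnergy s v)) +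
      ENNReal.ofReal (1 + 1 / δ) * (ENNReal.ofReal (fracConst (d + 1) s / 2) * (A * (lineL2 v *
        ∫⁻ z : EuclideanSpace ℝ (Fin (d + 1)), ENNReal.ofReal
          (min 1 (M ^ 2 * ‖z‖ ^ 2) / ‖z‖ ^ (((d + 1 : ℕ) : ℝ) + 2 * s))))) := by
  have hηm := hη.measurable
  have hvm := hv.measurable
  have him : Measurable (initPoint (d := d)) := contDiff_initPoint.continuous.measurable
  rw [gagliardoSq_strip (by fun_prop)]
  simp only [initPoint_snocPoint, snocPoint_last]
  set C := ENNReal.ofReal (fracConst (d + 1) s / 2) with hC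
  set N := ∫⁻ x, ENNReal.ofReal (η x ^ 2) with hN
  set F : EuclideanSpace ℝ (Fin (d + 1)) → ℝ≥0∞ := fun z => ENNReal.ofReal
          (min 1 (M ^ 2 * ‖z‖ ^ 2) / ‖z‖ ^ (((d + 1 : ℕ) : ℝ) + 2 * s)) with hF
  have hFm : Measurable F := by fun_prop
  set D1 := ENNReal.ofReal (1 + δ) with hD1
  set D2 := ENNReal.ofReal (1 + 1 / δ) with hD2
  set K : EuclideanSpace ℝ (Fin d) → ℝ → ℝ≥0∞ := fun z t =>
    ENNReal.ofReal (1 / (‖z‖ ^ 2 + t ^ 2) ^ (((d + 1 : ℕ) + 2 * s) / 2)) with hK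
  have hKm : ∀ t, Measurable fun z => K z t := fun t => by fun_prop
  have inner : ∀ a b, ∫⁻ z, ∫⁻ x, K z (a - b) *
      ENNReal.ofReal ((η x * v a - η (x + z) * v b) ^ 2) ≤
      D1 * N * (ENNReal.ofReal ((v a - v b) ^ 2) * ∫⁻ z, K z (a - b)) +
      D2 * A * (ENNReal.ofReal (v b ^ 2) * ∫⁻ z, F (snocPoint z (a - b))) := by
    intro a b
    calc _ ≤ ∫⁻ z, (D1 * N * (ENNReal.ofReal ((v a - v b) ^ 2) * K z (a - b)) +
          D2 * A * (ENNReal.ofReal (v b ^ 2) * F (snocPoint z (a - b)))) := by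
          refine lintegral_mono fun z => ?_
          -- Enlarging `‖z‖` to the norm of `(z, a - b)` makes the error kernel a function `F` on
          -- `ℝ^(d+1)`, to be integrated over the whole space.
          have hKF : K z (a - b) * ENNReal.ofReal (min 1 (M ^ 2 * ‖z‖ ^ 2)) ≤
              F (snocPoint z (a - b)) := by
            have h1 := norm_snocPoint_sub_sq z 0 (a - b) 0
            have h2 := norm_snocPoint_sub_rpow z 0 (a - b) 0 (((d + 1 : ℕ) : ℝ) + 2 * s)
            have h3 : snocPoint (0 : EuclideanSpace ℝ (Fin d)) 0 = 0 := by
              ext i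
              refine Fin.lastCases ?_ (fun j => ?_) i <;> simp
            simp only [h3, sub_zero] at h1 h2
            simp only [hK, hF, h1, h2]
            rw [← ENNReal.ofReal_mul (by positivity), one_div_mul_eq_div]
            gcongr
            nlinarith [sq_nonneg (a - b)]
          calc _ ≤ ∫⁻ x, K z (a - b) * (D1 * ENNReal.ofReal ((v a - v b) ^ 2) *
                ENNReal.ofReal (η x ^ 2) + D2 * ENNReal.ofReal (v b ^ 2) *
                ENNReal.ofReal ((η x - η (x + z)) ^ 2)) := by
                refine lintegral_mono fun x => ?_
                dsimp only
                gcongr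
                have h1 := ofReal_sq_add_div_le hδ (η x * (v a - v b))
                  (v b * (η x - η (x + z))) zero_le_one
                simp only [div_one] at h1
                rw [show η x * v a - η (x + z) * v b =
                  η x * (v a - v b) + v b * (η x - η (x + z)) by ring]
                refine h1.trans_eq ?_
                rw [mul_pow, mul_pow, ENNReal.ofReal_mul (sq_nonneg _),
                  ENNReal.ofReal_mul (sq_nonneg _)]
                ring
            _ = K z (a - b) * (D1 * ENNReal.ofReal ((v a - v b) ^ 2) * N +
                D2 * ENNReal.ofReal (v b ^ 2) *
                ∫⁻ x, ENNReal.ofReal ((η x - η (x + z)) ^ 2)) := by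
                rw [lintegral_const_mul _ (by fun_prop), lintegral_add_left (by fun_prop),
                  lintegral_const_mul _ (by fun_prop), lintegral_const_mul _ (by fun_prop)]
            _ ≤ K z (a - b) * (D1 * ENNReal.ofReal ((v a - v b) ^ 2) * N +
                D2 * ENNReal.ofReal (v b ^ 2) *
                (ENNReal.ofReal (min 1 (M ^ 2 * ‖z‖ ^ 2)) * A)) := by
                gcongr
                exact hA z
            _ = D1 * N * (ENNReal.ofReal ((v a - v b) ^ 2) * K z (a - b)) +
                D2 * A * (ENNReal.ofReal (v b ^ 2) *
                  (K z (a - b) * ENNReal.ofReal (min 1 (M ^ 2 * ‖z‖ ^ 2)))) := by ring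
            _ ≤ _ := by gcongr
      _ = _ := by
          have hm1 := hKm (a - b)
          have hm2 : Measurable fun z => F (snocPoint z (a - b)) :=
            hFm.comp (measurable_snocPoint.comp (measurable_id.prodMk measurable_const))
          rw [lintegral_add_left ((hm1.const_mul _).const_mul _),
            lintegral_const_mul _ (hm1.const_mul _), lintegral_const_mul _ hm1,
            lintegral_const_mul _ (hm2.const_mul _), lintegral_const_mul _ hm2]
  have hGm : Measurable fun p : ℝ × ℝ => ∫⁻ z, F (snocPoint z (p.1 - p.2)) := by
    refine Measurable.lintegral_prod_right' (f := fun q : (ℝ × ℝ) × EuclideanSpace ℝ (Fin d) =>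
      F (snocPoint q.2 (q.1.1 - q.1.2))) ?_
    exact hFm.comp (measurable_snocPoint.comp
      (measurable_snd.prodMk (measurable_fst.fst.sub measurable_fst.snd)))
  have hGm2 : Measurable fun p : ℝ × ℝ => ENNReal.ofReal (v p.2 ^ 2) *
      ∫⁻ z, F (snocPoint z (p.1 - p.2)) :=
    ((hvm.comp measurable_snd).pow_const 2).ennreal_ofReal.mul hGm
  have hEm : Measurable fun p : ℝ × ℝ =>
      ENNReal.ofReal ((v p.1 - v p.2) ^ 2 / |p.1 - p.2| ^ (1 + 2 * s)) := by fun_prop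
  have hker : ∀ a b, C * (ENNReal.ofReal ((v a - v b) ^ 2) * ∫⁻ z, K z (a - b)) =
      ENNReal.ofReal (fracConst 1 s / 2) *
        ENNReal.ofReal ((v a - v b) ^ 2 / |a - b| ^ (1 + 2 * s)) := by
    intro a b
    by_cases hab : a = b
    · simp [hab]
    rw [mul_left_comm, fracConst_mul_lintegral_kernel d hs hs1 (sub_ne_zero.2 hab),
      div_eq_mul_one_div ((v a - v b) ^ 2), ENNReal.ofReal_mul (sq_nonneg _)]
    ring
  -- For fixed `b`, extending the `a`-integral to the whole line and translating gives the full
  -- integral of `F`, independent of `b`.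
  have hsecond : ∫⁻ a in Set.Ioo (-1 : ℝ) 1, ∫⁻ b in Set.Ioo (-1 : ℝ) 1,
      ENNReal.ofReal (v b ^ 2) * ∫⁻ z, F (snocPoint z (a - b)) ≤ lineL2 v * ∫⁻ z, F z := by
    rw [lintegral_lintegral_swap hGm2.aemeasurable]
    unfold lineL2
    rw [← lintegral_mul_const _ (by fun_prop)]
    refine lintegral_mono fun b => ?_
    dsimp only
    rw [lintegral_const_mul' _ _ ENNReal.ofReal_ne_top]
    gcongr
    rw [← lintegral_lintegral_snocPoint_sub hFm b]
    exact setLIntegral_le_lintegral _ _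
  calc _ ≤ C * ∫⁻ a in Set.Ioo (-1 : ℝ) 1, ∫⁻ b in Set.Ioo (-1 : ℝ) 1,
        (D1 * N * (ENNReal.ofReal ((v a - v b) ^ 2) * ∫⁻ z, K z (a - b)) +
        D2 * A * (ENNReal.ofReal (v b ^ 2) * ∫⁻ z, F (snocPoint z (a - b)))) := by
        gcongr with a b
        exact inner a b
    _ = ∫⁻ a in Set.Ioo (-1 : ℝ) 1, ∫⁻ b in Set.Ioo (-1 : ℝ) 1,
        (D1 * N * ENNReal.ofReal (fracConst 1 s / 2) *
          ENNReal.ofReal ((v a - v b) ^ 2 / |a - b| ^ (1 + 2 * s)) +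
        C * D2 * A * (ENNReal.ofReal (v b ^ 2) * ∫⁻ z, F (snocPoint z (a - b)))) := by
        rw [← lintegral_const_mul' _ _ ENNReal.ofReal_ne_top]
        refine lintegral_congr fun a => ?_
        rw [← lintegral_const_mul' _ _ ENNReal.ofReal_ne_top]
        refine lintegral_congr fun b => ?_
        rw [mul_add, mul_left_comm C, hker]
        ring
    _ = D1 * N * ENNReal.ofReal (fracConst 1 s / 2) * lineEnergy s v +
        C * D2 * A * ∫⁻ a in Set.Ioo (-1 : ℝ) 1, ∫⁻ b in Set.Ioo (-1 : ℝ) 1,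
          ENNReal.ofReal (v b ^ 2) * ∫⁻ z, F (snocPoint z (a - b)) := by
        have h1 : ∀ a, ∫⁻ b in Set.Ioo (-1 : ℝ) 1,
            (D1 * N * ENNReal.ofReal (fracConst 1 s / 2) *
              ENNReal.ofReal ((v a - v b) ^ 2 / |a - b| ^ (1 + 2 * s)) +
            C * D2 * A * (ENNReal.ofReal (v b ^ 2) * ∫⁻ z, F (snocPoint z (a - b)))) =
            D1 * N * ENNReal.ofReal (fracConst 1 s / 2) * (∫⁻ b in Set.Ioo (-1 : ℝ) 1,
              ENNReal.ofReal ((v a - v b) ^ 2 / |a - b| ^ (1 + 2 * s))) +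
            C * D2 * A * ∫⁻ b in Set.Ioo (-1 : ℝ) 1,
              ENNReal.ofReal (v b ^ 2) * ∫⁻ z, F (snocPoint z (a - b)) := by
          intro a
          have hm1 : Measurable fun b =>
            ENNReal.ofReal ((v a - v b) ^ 2 / |a - b| ^ (1 + 2 * s)) := by fun_prop
          have hm2 : Measurable fun b => ENNReal.ofReal (v b ^ 2) *
              ∫⁻ z, F (snocPoint z (a - b)) := hGm2.comp measurable_prodMk_left
          rw [lintegral_add_left (hm1.const_mul _), lintegral_const_mul _ hm1,
            lintegral_const_mul _ hm2]
        simp_rw [h1]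
        have hm3 := hEm.lintegral_prod_right' (ν := volume.restrict (Set.Ioo (-1 : ℝ) 1))
        have hm4 := hGm2.lintegral_prod_right' (ν := volume.restrict (Set.Ioo (-1 : ℝ) 1))
        rw [lintegral_add_left (hm3.const_mul _), lintegral_const_mul _ hm3,
          lintegral_const_mul _ hm4]
        rfl
    _ ≤ D1 * N * ENNReal.ofReal (fracConst 1 s / 2) * lineEnergy s v +
        C * D2 * A * (lineL2 v * ∫⁻ z, F z) := by gcongr
    _ = _ := by ring

theorem l2Sq_strip_mul {η : EuclideanSpace ℝ (Fin d) → ℝ} (hη : Continuous η) {v : ℝ → ℝ}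
    (hv : Continuous v) :
    l2Sq (d + 1) (strip d) (fun z => η (initPoint z) * v (z (Fin.last d))) =
      (∫⁻ x, ENNReal.ofReal (η x ^ 2)) * lineL2 v := by
  have hηm := hη.measurable
  have hvm := hv.measurable
  have him : Measurable (initPoint (d := d)) := contDiff_initPoint.continuous.measurable
  rw [l2Sq_strip (by fun_prop)]
  simp only [initPoint_snocPoint, snocPoint_last]
  unfold lineL2
  rw [← lintegral_const_mul _ (by fun_prop)]
  refine lintegral_congr fun a => ?_
  rw [← lintegral_mul_const _ (by fun_prop)]
  refine lintegral_congr fun x => ?_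
  rw [mul_pow, ENNReal.ofReal_mul (sq_nonneg _)]

-- Test the strip with `η(x) v(t)` and divide by `∫ η²`. The scale of `η` is chosen after `δ` and
-- `e`, so that the integral of the error kernel is below `e`; the factor `∫ η²` in the cutoff bound
-- makes the error survive this division uniformly.
open Filter Topology in
theorem le_regionalPoincare_interval_of_strip (hs : 0 < s) (hs1 : s < 1) {c : ℝ≥0∞} (hc : c ≠ ⊤)
    (h : c ≤ regionalPoincare (d + 1) s (strip d)) :
    c ≤ regionalPoincare 1 s interval11 := by
  rw [le_regionalPoincare_iff hs hs1 hc] at h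
  rw [le_regionalPoincare_interval11_iff hs hs1 hc]
  intro v hv
  have hv2 : lineL2 v ≠ ⊤ := by
    have h1 : MemLp v 2 volume := hv.1.continuous.memLp_of_hasCompactSupport hv.2.1
    have h2 := (h1.restrict (Set.Ioo (-1 : ℝ) 1)).integrable_sq.lintegral_lt_top
    exact h2.ne
  refine ENNReal.le_of_forall_le_one_add_mul fun δ hδ => ?_
  refine ENNReal.le_of_forall_le_add_mul (K := ENNReal.ofReal (1 + 1 / δ) *
    (ENNReal.ofReal (fracConst (d + 1) s / 2) * (2 ^ (d + 1) * lineL2 v))) (by finiteness)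
    fun e he => ?_
  obtain ⟨k, hk⟩ := ((tendsto_lintegral_min_one_sq_div d hs hs1).eventually
    (gt_mem_nhds he)).exists
  obtain ⟨η, hη, hηs, hN0, hNt, hdiff⟩ := exists_cutoff d (M := 1 / ((k : ℝ) + 1)) (by positivity)
  have h1 := h _ (isTestFunction_strip_mul hη hηs hv)
  rw [l2Sq_strip_mul hη.continuous hv.1.continuous] at h1
  have h2 := h1.trans
    (gagliardoSq_strip_mul_le hs hs1 hη.continuous hv.1.continuous hdiff hδ)
  rw [← ENNReal.mul_le_mul_iff_right hN0 hNt]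
  calc _ = c * ((∫⁻ x, ENNReal.ofReal (η x ^ 2)) * lineL2 v) := by ring
    _ ≤ _ := h2
    _ ≤ ENNReal.ofReal (1 + δ) * ((∫⁻ x, ENNReal.ofReal (η x ^ 2)) *
        (ENNReal.ofReal (fracConst 1 s / 2) * lineEnergy s v)) +
      ENNReal.ofReal (1 + 1 / δ) * (ENNReal.ofReal (fracConst (d + 1) s / 2) *
        ((2 ^ (d + 1) * ∫⁻ x, ENNReal.ofReal (η x ^ 2)) * (lineL2 v * e))) := by gcongr
    _ = _ := by ring

theorem regionalPoincare_strip_eq (hs : 0 < s) (hs1 : s < 1) :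
    regionalPoincare (d + 1) s (strip d) = regionalPoincare 1 s interval11 := by
  refine le_antisymm ?_ ?_ <;> refine ENNReal.le_of_forall_nnreal_lt fun c hc => ?_
  · exact le_regionalPoincare_interval_of_strip hs hs1 ENNReal.coe_ne_top hc.le
  · exact le_regionalPoincare_strip_of_interval hs hs1 ENNReal.coe_ne_top hc.le

end

/-! ### Positivity on the interval for `s > 1/2` -/

section

variable {s : ℝ}

theorem ofReal_sq_le_weighted {δ : ℝ} (hδ : 0 < δ) (p q : ℝ) :
    ENNReal.ofReal (p ^ 2) ≤ ENNReal.ofReal (1 + δ) * ENNReal.ofReal (q ^ 2) +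
      ENNReal.ofReal (1 + 1 / δ) * ENNReal.ofReal ((p - q) ^ 2) := by
  have := ofReal_sq_add_div_le hδ q (p - q) zero_le_one
  simpa using this

/-- Comparison of the `L²` masses of `v` over `(-1, -1 + 2h)` and over `(-1, -1 + h)`. -/
theorem setLIntegral_Ioo_two_mul_le (hs : 0 < s) {v : ℝ → ℝ} (hv : Continuous v) {h : ℝ}
    (h0 : 0 < h) (h1 : h ≤ 1) {δ : ℝ} (hδ : 0 < δ) :
    ∫⁻ x in Set.Ioo (-1 : ℝ) (-1 + 2 * h), ENNReal.ofReal (v x ^ 2) ≤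
      ENNReal.ofReal (2 * (1 + δ)) * (∫⁻ x in Set.Ioo (-1 : ℝ) (-1 + h), ENNReal.ofReal (v x ^ 2)) +
      ENNReal.ofReal (2 * (1 + 1 / δ) * (2 * h) ^ (2 * s)) * lineEnergy s v := by
  have hvm := hv.measurable
  set J := Set.Ioo (-1 : ℝ) (-1 + 2 * h) with hJ
  set J' := Set.Ioo (-1 : ℝ) (-1 + h) with hJ'
  have vJ : volume J = ENNReal.ofReal (2 * h) := by
    rw [hJ, Real.volume_Ioo]
    congr 1
    ring
  have vJ' : volume J' = ENNReal.ofReal h := by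
    rw [hJ', Real.volume_Ioo]
    congr 1
    ring
  have hJI : J ⊆ Set.Ioo (-1 : ℝ) 1 := Set.Ioo_subset_Ioo_right (by linarith)
  have hJI' : J' ⊆ Set.Ioo (-1 : ℝ) 1 := Set.Ioo_subset_Ioo_right (by linarith)
  have hdiff : ∀ x ∈ J, ∀ y ∈ J', ENNReal.ofReal ((v x - v y) ^ 2) ≤
      ENNReal.ofReal ((2 * h) ^ (1 + 2 * s)) *
        ENNReal.ofReal ((v x - v y) ^ 2 / |x - y| ^ (1 + 2 * s)) := by
    intro x hx y hy
    by_cases hxy : x = y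
    · simp [hxy]
    have hpos : 0 < |x - y| := abs_pos.2 (sub_ne_zero.2 hxy)
    have hle : |x - y| ≤ 2 * h := by
      rw [abs_le]
      constructor <;> linarith [hx.1, hx.2, hy.1, hy.2]
    rw [← ENNReal.ofReal_mul (by positivity)]
    apply ENNReal.ofReal_le_ofReal
    rw [mul_div_assoc', le_div_iff₀ (by positivity), mul_comm]
    gcongr
  -- Integrate the weighted inequality for `v(x)²` over `x ∈ J`, `y ∈ J'`. The ratio `|J| / |J'| =
  -- 2` gives the leading factor, and `|x - y| ≤ 2h` turns the differences into energy.
  have key : ENNReal.ofReal h * ∫⁻ x in J, ENNReal.ofReal (v x ^ 2) ≤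
      ENNReal.ofReal (1 + δ) * ENNReal.ofReal (2 * h) * (∫⁻ y in J', ENNReal.ofReal (v y ^ 2)) +
      ENNReal.ofReal (1 + 1 / δ) * (ENNReal.ofReal ((2 * h) ^ (1 + 2 * s)) * lineEnergy s v) := by
    calc ENNReal.ofReal h * ∫⁻ x in J, ENNReal.ofReal (v x ^ 2)
        = ∫⁻ x in J, ∫⁻ _ in J', ENNReal.ofReal (v x ^ 2) := by
          simp_rw [setLIntegral_const, vJ']
          rw [lintegral_mul_const _ (by fun_prop), mul_comm]
      _ ≤ ∫⁻ x in J, ∫⁻ y in J', (ENNReal.ofReal (1 + δ) * ENNReal.ofReal (v y ^ 2) +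
          ENNReal.ofReal (1 + 1 / δ) * ENNReal.ofReal ((v x - v y) ^ 2)) := by
          gcongr with x y
          exact ofReal_sq_le_weighted hδ _ _
      _ = ENNReal.ofReal (1 + δ) * ENNReal.ofReal (2 * h) *
          (∫⁻ y in J', ENNReal.ofReal (v y ^ 2)) +
          ENNReal.ofReal (1 + 1 / δ) * ∫⁻ x in J, ∫⁻ y in J', ENNReal.ofReal ((v x - v y) ^ 2) := by
          have h2 : ∀ x, ∫⁻ y in J', (ENNReal.ofReal (1 + δ) * ENNReal.ofReal (v y ^ 2) +
              ENNReal.ofReal (1 + 1 / δ) * ENNReal.ofReal ((v x - v y) ^ 2)) =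
              ENNReal.ofReal (1 + δ) * (∫⁻ y in J', ENNReal.ofReal (v y ^ 2)) +
              ENNReal.ofReal (1 + 1 / δ) * ∫⁻ y in J', ENNReal.ofReal ((v x - v y) ^ 2) := by
            intro x
            rw [lintegral_add_left (by fun_prop), lintegral_const_mul _ (by fun_prop),
              lintegral_const_mul _ (by fun_prop)]
          simp_rw [h2]
          rw [lintegral_add_left (by fun_prop), setLIntegral_const, vJ,
            lintegral_const_mul' _ _ ENNReal.ofReal_ne_top]
          ring
      _ ≤ _ := by
          gcongr
          unfold lineEnergy
          calc _ ≤ ∫⁻ x in J, ∫⁻ y in J', ENNReal.ofReal ((2 * h) ^ (1 + 2 * s)) *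
                ENNReal.ofReal ((v x - v y) ^ 2 / |x - y| ^ (1 + 2 * s)) :=
                setLIntegral_mono' measurableSet_Ioo fun x hx =>
                  setLIntegral_mono' measurableSet_Ioo fun y hy => hdiff x hx y hy
            _ ≤ ∫⁻ x in Set.Ioo (-1 : ℝ) 1, ∫⁻ y in Set.Ioo (-1 : ℝ) 1,
                ENNReal.ofReal ((2 * h) ^ (1 + 2 * s)) *
                ENNReal.ofReal ((v x - v y) ^ 2 / |x - y| ^ (1 + 2 * s)) := by
                refine (lintegral_mono_set hJI).trans (lintegral_mono fun x => ?_)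
                exact lintegral_mono_set hJI'
            _ = _ := by
                rw [← lintegral_const_mul' _ _ ENNReal.ofReal_ne_top]
                refine lintegral_congr fun x => ?_
                rw [lintegral_const_mul' _ _ ENNReal.ofReal_ne_top]
  rw [← ENNReal.mul_le_mul_iff_right (a := ENNReal.ofReal h) (by simpa using h0)
    ENNReal.ofReal_ne_top]
  refine key.trans_eq ?_
  rw [mul_add, ← mul_assoc, ← mul_assoc, ← mul_assoc, ← ENNReal.ofReal_mul (by positivity),
    ← ENNReal.ofReal_mul (by positivity), ← ENNReal.ofReal_mul (by positivity),
    ← ENNReal.ofReal_mul (by positivity), Real.rpow_add (by positivity), Real.rpow_one]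
  congr 3 <;> ring

theorem exists_setLIntegral_Ioo_eq_zero {v : ℝ → ℝ} (hv : IsLineTest v) :
    ∃ k : ℕ, ∫⁻ x in Set.Ioo (-1 : ℝ) (-1 + 2 * (1 / 2) ^ k), ENNReal.ofReal (v x ^ 2) = 0 := by
  have h1 : (-1 : ℝ) ∉ tsupport v := fun h => lt_irrefl _ (hv.2.2 h).1
  rw [notMem_tsupport_iff_eventuallyEq, Filter.EventuallyEq, Metric.eventually_nhds_iff] at h1
  obtain ⟨ε, hε, h2⟩ := h1
  obtain ⟨k, hk⟩ := exists_pow_lt_of_lt_one (half_pos hε) (by norm_num : (1 / 2 : ℝ) < 1)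
  refine ⟨k, ?_⟩
  rw [← lintegral_zero (μ := volume.restrict (Set.Ioo (-1 : ℝ) (-1 + 2 * (1 / 2) ^ k)))]
  refine setLIntegral_congr_fun measurableSet_Ioo fun x hx => ?_
  have : v x = 0 := by
    refine h2 ?_
    rw [Real.dist_eq, abs_lt]
    constructor <;> linarith [hx.1, hx.2]
  simp [this]

/-- A telescoping form of Hardy's idea: halve the interval towards `-1`. Each halving multiplies the
mass coefficient by `q` and the scale factor of the energy by `2^(-2s)`, so the accumulated energy
coefficients are geometric with ratio `ρ = q 2^(-2s)`. -/
theorem exists_lineL2_le (hs : 1 / 2 < s) :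
    ∃ K : ℝ≥0∞, K ≠ ⊤ ∧ ∀ v, IsLineTest v → lineL2 v ≤ K * lineEnergy s v := by
  -- Makes `q = 2^(s + 1/2)` and hence `ρ = 2^(1/2 - s) < 1`. Some `δ > 0` with `2 (1 + δ) < 2^(2s)`
  -- exists exactly because `s > 1/2`.
  set δ : ℝ := 2 ^ (s - 1 / 2) - 1 with hδ
  have hδ0 : 0 < δ := by
    have := Real.one_lt_rpow (x := 2) (z := s - 1 / 2) one_lt_two (by linarith)
    linarith
  set ρ : ℝ := 2 ^ (1 / 2 - s) with hρ
  have hρ0 : 0 < ρ := by positivity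
  have hρ1 : ρ < 1 := Real.rpow_lt_one_of_one_lt_of_neg one_lt_two (by linarith)
  set q : ℝ := 2 * (1 + δ) with hq
  have hq0 : 0 < q := by positivity
  set D : ℝ := 2 * (1 + 1 / δ) * 2 ^ (2 * s) with hD
  have hD0 : 0 < D := by positivity
  have hqρ : q * (1 / 2) ^ (2 * s) = ρ := by
    have h1 : q = 2 ^ (s + 1 / 2) := by
      rw [hq, hδ, show s + 1 / 2 = 1 + (s - 1 / 2) by ring, Real.rpow_add two_pos, Real.rpow_one]
      ring
    rw [h1, one_div, Real.inv_rpow two_pos.le, ← Real.rpow_neg two_pos.le,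
      ← Real.rpow_add two_pos, hρ]
    congr 1
    ring
  refine ⟨ENNReal.ofReal D * (1 - ENNReal.ofReal ρ)⁻¹, ?_, fun v hv => ?_⟩
  · refine ENNReal.mul_ne_top ENNReal.ofReal_ne_top (ENNReal.inv_ne_top.2 ?_)
    rw [Ne, tsub_eq_zero_iff_le, not_le, ENNReal.ofReal_lt_one]
    exact hρ1
  set B : ℕ → ℝ≥0∞ := fun k =>
    ∫⁻ x in Set.Ioo (-1 : ℝ) (-1 + 2 * (1 / 2) ^ k), ENNReal.ofReal (v x ^ 2) with hB
  have step : ∀ k, B k ≤ ENNReal.ofReal q * B (k + 1) +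
      ENNReal.ofReal (D * ((1 / 2) ^ (2 * s)) ^ k) * lineEnergy s v := by
    intro k
    have h := setLIntegral_Ioo_two_mul_le (s := s) (by linarith) hv.1.continuous
      (h := (1 / 2) ^ k) (by positivity) (pow_le_one₀ (by norm_num) (by norm_num)) hδ0
    have e1 : (2 : ℝ) * (1 / 2) ^ (k + 1) = (1 / 2) ^ k := by rw [pow_succ]; ring
    have e2 : 2 * (1 + 1 / δ) * (2 * (1 / 2) ^ k) ^ (2 * s) = D * ((1 / 2) ^ (2 * s)) ^ k := by
      rw [Real.mul_rpow two_pos.le (by positivity), hD, ← Real.rpow_natCast, ← Real.rpow_natCast,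
        ← Real.rpow_mul (by norm_num), ← Real.rpow_mul (by norm_num), mul_comm (k : ℝ)]
      ring
    rw [e2] at h
    simp only [hB, e1]
    exact h
  have iter : ∀ k, B 0 ≤ ENNReal.ofReal q ^ k * B k + ∑ j ∈ Finset.range k,
      ENNReal.ofReal ρ ^ j * (ENNReal.ofReal D * lineEnergy s v) := by
    intro k
    induction k with
    | zero => simp
    | succ k ih =>
      refine ih.trans ?_
      rw [Finset.sum_range_succ, add_comm (∑ j ∈ Finset.range k, _), ← add_assoc]
      gcongr
      calc _ ≤ ENNReal.ofReal q ^ k * (ENNReal.ofReal q * B (k + 1) +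
            ENNReal.ofReal (D * ((1 / 2) ^ (2 * s)) ^ k) * lineEnergy s v) := by
            gcongr
            exact step k
        _ = _ := by
            rw [ENNReal.ofReal_mul hD0.le, ENNReal.ofReal_pow (by positivity), ← hqρ,
              ENNReal.ofReal_mul hq0.le]
            ring
  -- The factor `q^k` grows, but `B k` is eventually exactly zero. How soon depends on `v`; the
  -- bound by the full geometric series does not.
  obtain ⟨k, hk⟩ := exists_setLIntegral_Ioo_eq_zero hv
  have hB0 : B 0 = lineL2 v := by
    simp only [hB, lineL2]
    norm_num
  rw [← hB0]
  refine (iter k).trans ?_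
  rw [show B k = 0 from hk, mul_zero, zero_add, ← Finset.sum_mul]
  calc _ ≤ (1 - ENNReal.ofReal ρ)⁻¹ * (ENNReal.ofReal D * lineEnergy s v) := by
        gcongr
        rw [← ENNReal.tsum_geometric]
        exact ENNReal.sum_le_tsum _
    _ = _ := by ring

theorem regionalPoincare_interval11_pos (hs : 1 / 2 < s) (hs1 : s < 1) :
    0 < regionalPoincare 1 s interval11 := by
  have hs0 : 0 < s := by linarith
  obtain ⟨K, hK, h⟩ := exists_lineL2_le hs
  have hC := fracConst_pos 1 hs0 hs1
  have hC0 : ENNReal.ofReal (fracConst 1 s / 2) ≠ 0 := by simpa using hC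
  -- Using `K + 1` instead of `K` avoids a possible division by zero.
  have hK1 : K + 1 ≠ ⊤ := by simp [hK]
  have hc : ENNReal.ofReal (fracConst 1 s / 2) / (K + 1) ≠ ⊤ :=
    ENNReal.div_ne_top ENNReal.ofReal_ne_top (by simp)
  refine (ENNReal.div_pos hC0 hK1).trans_le
    ((le_regionalPoincare_interval11_iff hs0 hs1 hc).2 fun v hv => ?_)
  calc _ ≤ ENNReal.ofReal (fracConst 1 s / 2) / (K + 1) * ((K + 1) * lineEnergy s v) := by
        gcongr
        refine (h v hv).trans ?_
        gcongr
        exact le_self_add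
    _ = _ := by
        rw [← mul_assoc, ENNReal.div_mul_cancel (by simp) hK1]

end

/-! ### Vanishing on the interval for `s ≤ 1/2` -/

theorem exists_smoothTransition_lipschitz :
    ∃ L : ℝ, 0 < L ∧ ∀ x y, |Real.smoothTransition x - Real.smoothTransition y| ≤ L * |x - y| := by
  obtain ⟨L, hL⟩ := ContDiffOn.exists_lipschitzOnWith (s := Set.Icc (0 : ℝ) 1) (n := 1)
    (Real.smoothTransition.contDiff (n := 1)).contDiffOn one_ne_zero (convex_Icc 0 1) isCompact_Icc
  refine ⟨L + 1, by positivity, fun x y => ?_⟩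
  -- The transition is constant on each side of `[0, 1]`, so a Lipschitz bound on that compact
  -- interval is global after projection.
  rw [← Real.smoothTransition.projIcc (x := x), ← Real.smoothTransition.projIcc (x := y)]
  have h1 := hL.dist_le_mul _ (Set.projIcc (0 : ℝ) 1 zero_le_one x).2 _
    (Set.projIcc (0 : ℝ) 1 zero_le_one y).2
  rw [Real.dist_eq] at h1
  have h2 : |(Set.projIcc (0 : ℝ) 1 zero_le_one x : ℝ) - Set.projIcc (0 : ℝ) 1 zero_le_one y| ≤
      |x - y| := Set.abs_projIcc_sub_projIcc _
  refine h1.trans ?_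
  rw [Real.dist_eq]
  gcongr
  linarith

/-- The union of the two intervals of length `h` at the ends of `(-1, 1)`. -/
def endLayer (h : ℝ) : Set ℝ := Set.Ioo (-1) (-1 + h) ∪ Set.Ioo (1 - h) 1

theorem measurableSet_endLayer (h : ℝ) : MeasurableSet (endLayer h) :=
  measurableSet_Ioo.union measurableSet_Ioo

theorem volume_endLayer_le {h : ℝ} (hh : 0 ≤ h) : volume (endLayer h) ≤ ENNReal.ofReal (2 * h) := by
  refine (measure_union_le _ _).trans ?_
  rw [Real.volume_Ioo, Real.volume_Ioo, ← ENNReal.ofReal_add (by linarith) (by linarith)]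
  apply ENNReal.ofReal_le_ofReal
  linarith

/-- A double integral over pairs with at least one point in `S`, with translation-invariant
bound `g`. -/
theorem setLIntegral_setLIntegral_le_of_le_indicator {I S : Set ℝ} (hI : MeasurableSet I)
    (hS : MeasurableSet S) {w : ℝ → ℝ → ℝ≥0∞} {g : ℝ → ℝ≥0∞} (hg : Measurable g)
    (h : ∀ a ∈ I, ∀ b ∈ I, w a b ≤ g (a - b) * (S.indicator 1 a + S.indicator 1 b)) :
    ∫⁻ a in I, ∫⁻ b in I, w a b ≤ 2 * volume S * ∫⁻ t, g t := by
  have hSm : Measurable (S.indicator (1 : ℝ → ℝ≥0∞)) := measurable_one.indicator hS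
  calc _ ≤ ∫⁻ a in I, ∫⁻ b in I, g (a - b) * (S.indicator 1 a + S.indicator 1 b) :=
        setLIntegral_mono' hI fun a ha => setLIntegral_mono' hI fun b hb => h a ha b hb
    _ ≤ ∫⁻ a, ∫⁻ b, g (a - b) * (S.indicator 1 a + S.indicator 1 b) :=
        (setLIntegral_le_lintegral _ _).trans
          (lintegral_mono fun a => setLIntegral_le_lintegral _ _)
    _ = ∫⁻ a, ((S.indicator 1 a * ∫⁻ t, g t) + ∫⁻ b, g (a - b) * S.indicator 1 b) := by
        refine lintegral_congr fun a => ?_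
        have hga : Measurable fun b => g (a - b) := hg.comp (measurable_id.const_sub a)
        simp_rw [mul_add]
        rw [lintegral_add_left (hga.mul_const _), lintegral_mul_const _ hga,
          lintegral_sub_left_eq_self g a, mul_comm]
    _ = volume S * (∫⁻ t, g t) + ∫⁻ b, ∫⁻ a, g (a - b) * S.indicator 1 b := by
        rw [lintegral_add_left (hSm.mul_const _), lintegral_mul_const _ hSm,
          lintegral_indicator_one hS, lintegral_lintegral_swap]
        refine Measurable.aemeasurable ?_
        exact (hg.comp (measurable_fst.sub measurable_snd)).mul (hSm.comp measurable_snd)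
    _ = volume S * (∫⁻ t, g t) + volume S * (∫⁻ t, g t) := by
        congr 1
        have h1 : ∀ b, ∫⁻ a, g (a - b) * S.indicator 1 b = S.indicator 1 b * ∫⁻ t, g t := by
          intro b
          have hgb : Measurable fun a => g (a - b) := hg.comp (measurable_id.sub_const b)
          rw [lintegral_mul_const _ hgb, lintegral_sub_right_eq_self g b, mul_comm]
        simp_rw [h1]
        rw [lintegral_mul_const _ hSm, lintegral_indicator_one hS]
    _ = _ := by ring

/-- A smooth cutoff on `(-1, 1)`, equal to `1` at distance at least `2 / k` from the end points. -/
noncomputable def endCutoff (k : ℝ) (x : ℝ) : ℝ := Real.smoothTransition (k * (1 - x ^ 2) - 1)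

theorem endCutoff_eq_one {k : ℝ} (hk : 0 < k) {x : ℝ} (hx : x ∈ Set.Ioo (-1 : ℝ) 1)
    (hx2 : x ∉ endLayer (2 / k)) : endCutoff k x = 1 := by
  refine Real.smoothTransition.one_of_one_le ?_
  have h1 : -1 + 2 / k ≤ x := by
    by_contra h
    exact hx2 (Or.inl ⟨hx.1, not_le.1 h⟩)
  have h2 : x ≤ 1 - 2 / k := by
    by_contra h
    exact hx2 (Or.inr ⟨not_le.1 h, hx.2⟩)
  have h3 : 2 / k ≤ 1 - x ^ 2 := by
    rcases le_total 0 x with h0 | h0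
    · nlinarith [hx.2]
    · nlinarith [hx.1]
  have h4 : 2 ≤ k * (1 - x ^ 2) := by
    rw [div_le_iff₀ hk] at h3
    linarith
  linarith

theorem isLineTest_endCutoff {k : ℝ} (hk : 0 < k) : IsLineTest (endCutoff k) := by
  have hK : IsCompact {x : ℝ | x ^ 2 ≤ 1 - 1 / k} := by
    refine (isCompact_Icc (a := (-1 : ℝ)) (b := 1)).of_isClosed_subset
      (isClosed_le (by fun_prop) continuous_const) fun x hx => ?_
    have h1 : x ^ 2 ≤ 1 - 1 / k := hx
    have h2 : 0 < 1 / k := by positivity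
    exact abs_le.1 (sq_le_one_iff_abs_le_one x |>.1 (by linarith))
  have hsupp : Function.support (endCutoff k) ⊆ {x : ℝ | x ^ 2 ≤ 1 - 1 / k} := by
    intro x hx
    by_contra h
    refine hx (Real.smoothTransition.zero_of_nonpos ?_)
    have h1 : 1 - 1 / k < x ^ 2 := not_le.1 h
    have h2 : 1 - x ^ 2 < 1 / k := by linarith
    rw [lt_div_iff₀ hk] at h2
    linarith
  refine ⟨?_, HasCompactSupport.of_support_subset_isCompact hK hsupp,
    (closure_minimal hsupp hK.isClosed).trans fun x hx => ?_⟩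
  · exact Real.smoothTransition.contDiff.comp (by fun_prop)
  · have h1 : x ^ 2 ≤ 1 - 1 / k := hx
    have h2 : 0 < 1 / k := by positivity
    exact abs_lt.1 ((sq_lt_one_iff_abs_lt_one x).1 (by linarith))

theorem abs_endCutoff_sub_le_one (k a b : ℝ) : |endCutoff k a - endCutoff k b| ≤ 1 := by
  have h1 := Real.smoothTransition.nonneg (k * (1 - a ^ 2) - 1)
  have h2 := Real.smoothTransition.le_one (k * (1 - a ^ 2) - 1)
  have h3 := Real.smoothTransition.nonneg (k * (1 - b ^ 2) - 1)
  have h4 := Real.smoothTransition.le_one (k * (1 - b ^ 2) - 1)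
  unfold endCutoff
  rw [abs_le]
  constructor <;> linarith

theorem abs_endCutoff_sub_le {L : ℝ} (hL0 : 0 < L)
    (hL : ∀ x y, |Real.smoothTransition x - Real.smoothTransition y| ≤ L * |x - y|)
    {k : ℝ} (hk : 0 < k) {a b : ℝ} (ha : a ∈ Set.Ioo (-1 : ℝ) 1) (hb : b ∈ Set.Ioo (-1 : ℝ) 1) :
    |endCutoff k a - endCutoff k b| ≤ 2 * L * k * |a - b| := by
  refine (hL _ _).trans ?_
  rw [show k * (1 - a ^ 2) - 1 - (k * (1 - b ^ 2) - 1) = -(k * (a + b) * (a - b)) by ring,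
    abs_neg, abs_mul, abs_mul, abs_of_pos hk]
  have : |a + b| ≤ 2 := by
    rw [abs_le]
    constructor <;> linarith [ha.1, ha.2, hb.1, hb.2]
  calc L * (k * |a + b| * |a - b|) ≤ L * (k * 2 * |a - b|) := by gcongr
    _ = _ := by ring

theorem endCutoff_sub_eq_zero {k : ℝ} (hk : 0 < k) {a b : ℝ} (ha : a ∈ Set.Ioo (-1 : ℝ) 1)
    (hb : b ∈ Set.Ioo (-1 : ℝ) 1) (ha2 : a ∉ endLayer (2 / k)) (hb2 : b ∉ endLayer (2 / k)) :
    endCutoff k a - endCutoff k b = 0 := by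
  rw [endCutoff_eq_one hk ha ha2, endCutoff_eq_one hk hb hb2, sub_self]

theorem le_mul_indicator_add_indicator {S : Set ℝ} {a b : ℝ} {w g : ℝ≥0∞} (h : w ≤ g)
    (h0 : a ∉ S → b ∉ S → w = 0) :
    w ≤ g * (S.indicator (1 : ℝ → ℝ≥0∞) a + S.indicator (1 : ℝ → ℝ≥0∞) b) := by
  by_cases ha : a ∈ S
  · refine h.trans (le_mul_of_one_le_right zero_le ?_)
    simp [Set.indicator_of_mem ha]
  by_cases hb : b ∈ S
  · refine h.trans (le_mul_of_one_le_right zero_le ?_)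
    simp [Set.indicator_of_mem hb]
  · simp [h0 ha hb]

theorem lintegral_div_one_add_sq {M : ℝ} (hM : 0 < M) :
    ∫⁻ t : ℝ, ENNReal.ofReal (2 * M ^ 2 * (1 + (M * t) ^ 2)⁻¹) =
      ENNReal.ofReal (2 * M * Real.pi) := by
  have h1 : Integrable fun t : ℝ => (1 + (M * t) ^ 2)⁻¹ :=
    integrable_inv_one_add_sq.comp_mul_left' hM.ne'
  rw [← ofReal_integral_eq_lintegral_ofReal (h1.const_mul _)
    (Filter.Eventually.of_forall fun t => by positivity), integral_const_mul,
    Measure.integral_comp_mul_left (fun t : ℝ => (1 + t ^ 2)⁻¹) M, integral_univ_inv_one_add_sq,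
    abs_of_pos (inv_pos.2 hM), smul_eq_mul]
  congr 1
  field_simp

theorem lineEnergy_half (v : ℝ → ℝ) : lineEnergy (1 / 2) v =
    ∫⁻ a in Set.Ioo (-1 : ℝ) 1, ∫⁻ b in Set.Ioo (-1 : ℝ) 1,
      ENNReal.ofReal ((v a - v b) ^ 2 / (a - b) ^ 2) := by
  unfold lineEnergy
  refine lintegral_congr fun a => lintegral_congr fun b => ?_
  rw [show (1 : ℝ) + 2 * (1 / 2) = ((2 : ℕ) : ℝ) by norm_num, Real.rpow_natCast, sq_abs]

/-- Scale invariance at order `1/2`. With `M = 2Lk` and `y = M² (a-b)²`, the squared difference is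
at most `min 1 y ≤ 2y/(1+y)`, so the integrand is bounded by a kernel of mass `2πM`. One of the
points must lie in a layer of measure at most `4/k`, and the powers of `k` cancel. -/
theorem exists_lineEnergy_endCutoff_le :
    ∃ B : ℝ≥0∞, 0 < B ∧ B ≠ ⊤ ∧ ∀ k : ℝ, 0 < k → lineEnergy (1 / 2) (endCutoff k) ≤ B := by
  obtain ⟨L, hL0, hL⟩ := exists_smoothTransition_lipschitz
  refine ⟨ENNReal.ofReal (32 * L * Real.pi), ?_, ENNReal.ofReal_ne_top, fun k hk => ?_⟩
  · rw [ENNReal.ofReal_pos]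
    have := Real.pi_pos
    positivity
  set M := 2 * L * k with hM
  have hM0 : 0 < M := by positivity
  rw [lineEnergy_half]
  have h := setLIntegral_setLIntegral_le_of_le_indicator (I := Set.Ioo (-1 : ℝ) 1)
    (S := endLayer (2 / k))
    (w := fun a b => ENNReal.ofReal ((endCutoff k a - endCutoff k b) ^ 2 / (a - b) ^ 2))
    (g := fun t => ENNReal.ofReal (2 * M ^ 2 * (1 + (M * t) ^ 2)⁻¹)) measurableSet_Ioo
    (measurableSet_endLayer _) (by fun_prop) (fun a ha b hb => by
      refine le_mul_indicator_add_indicator (ENNReal.ofReal_le_ofReal ?_) fun ha2 hb2 => ?_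
      · by_cases hab : a = b
        · simp only [hab, sub_self]
          norm_num
          positivity
        have hpos : 0 < (a - b) ^ 2 := by
          have := sub_ne_zero.2 hab
          positivity
        have h1 : (endCutoff k a - endCutoff k b) ^ 2 ≤ 1 := by
          rw [sq_le_one_iff_abs_le_one]
          exact abs_endCutoff_sub_le_one k a b
        have h2 : (endCutoff k a - endCutoff k b) ^ 2 ≤ (M * (a - b)) ^ 2 := by
          rw [sq_le_sq, abs_mul, abs_of_pos hM0]
          exact abs_endCutoff_sub_le hL0 hL hk ha hb
        rw [← div_eq_mul_inv, div_le_div_iff₀ hpos (by positivity)]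
        rw [mul_pow] at h2 ⊢
        set y := M ^ 2 * (a - b) ^ 2
        have hy : 0 ≤ y := by positivity
        nlinarith [sq_nonneg (endCutoff k a - endCutoff k b)]
      · simp [endCutoff_sub_eq_zero hk ha hb ha2 hb2])
  refine h.trans ?_
  rw [lintegral_div_one_add_sq hM0]
  calc _ ≤ 2 * ENNReal.ofReal (2 * (2 / k)) * ENNReal.ofReal (2 * M * Real.pi) := by
        gcongr
        exact volume_endLayer_le (by positivity)
    _ = _ := by
        rw [← ENNReal.ofReal_ofNat 2, ← ENNReal.ofReal_mul (by norm_num),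
          ← ENNReal.ofReal_mul (by positivity)]
        congr 1
        rw [hM]
        field_simp
        norm_num

/-- The mixed energy of two functions on `(-1, 1)`. -/
noncomputable def mixedEnergy (v w : ℝ → ℝ) : ℝ≥0∞ :=
  ∫⁻ a in Set.Ioo (-1 : ℝ) 1, ∫⁻ b in Set.Ioo (-1 : ℝ) 1,
    ENNReal.ofReal (|v a - v b| * |w a - w b| / (a - b) ^ 2)

theorem lintegral_indicator_abs_rpow_ne_top :
    ∫⁻ t : ℝ, (Set.Ioo (-2 : ℝ) 2).indicator (fun t => ENNReal.ofReal (|t| ^ (-(1 / 2) : ℝ))) t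
      ≠ ⊤ := by
  have h1 : IntegrableOn (fun t : ℝ => ‖t‖ ^ (-(1 / 2) : ℝ)) (Metric.ball 0 2) := by
    refine (integrableOn_fun_norm_addHaar volume (f := fun y : ℝ => y ^ (-(1 / 2) : ℝ))).2 ?_
    have h2 := intervalIntegral.intervalIntegrable_rpow' (a := 0) (b := 2)
      (show (-1 : ℝ) < -(1 / 2) by norm_num)
    rw [intervalIntegrable_iff_integrableOn_Ioo_of_le two_pos.le] at h2
    simpa using h2
  rw [lintegral_indicator measurableSet_Ioo]
  rw [Real.ball_eq_Ioo, zero_sub, zero_add] at h1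
  exact h1.lintegral_lt_top.ne

-- For fixed Lipschitz `v`, the integrand is at most `Λ √M |a-b|^(-1/2)` with `M` proportional to
-- `k`, which is integrable over bounded differences. The layer measure `4/k` leaves a bound of
-- order `k^(-1/2)`.
open Filter Topology in
theorem tendsto_mixedEnergy_endCutoff {v : ℝ → ℝ} (hv : IsLineTest v) :
    Tendsto (fun k : ℕ => mixedEnergy v (endCutoff (k + 1))) atTop (𝓝 0) := by
  obtain ⟨L, hL0, hL⟩ := exists_smoothTransition_lipschitz
  obtain ⟨Λ, hΛ⟩ := ContDiff.lipschitzWith_of_hasCompactSupport (𝕂 := ℝ) hv.2.1 hv.1 (by simp)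
  set G := ∫⁻ t : ℝ, (Set.Ioo (-2 : ℝ) 2).indicator
    (fun t => ENNReal.ofReal (|t| ^ (-(1 / 2) : ℝ))) t with hG
  have hbound : ∀ k : ℝ, 0 < k → mixedEnergy v (endCutoff k) ≤
      ENNReal.ofReal (8 * Λ * √(2 * L) / √k) * G := by
    intro k hk
    set M := 2 * L * k with hM
    have hM0 : 0 < M := by positivity
    have h := setLIntegral_setLIntegral_le_of_le_indicator (I := Set.Ioo (-1 : ℝ) 1)
      (S := endLayer (2 / k))
      (w := fun a b => ENNReal.ofReal (|v a - v b| * |endCutoff k a - endCutoff k b| / (a - b) ^ 2))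
      (g := fun t => ENNReal.ofReal (Λ * √M) * (Set.Ioo (-2 : ℝ) 2).indicator
        (fun t => ENNReal.ofReal (|t| ^ (-(1 / 2) : ℝ))) t) measurableSet_Ioo
      (measurableSet_endLayer _)
      (Measurable.const_mul (Measurable.indicator (by fun_prop) measurableSet_Ioo) _)
      (fun a ha b hb => by
        refine le_mul_indicator_add_indicator ?_ fun ha2 hb2 => ?_
        · have hmem : a - b ∈ Set.Ioo (-2 : ℝ) 2 :=
            ⟨by linarith [ha.1, hb.2], by linarith [ha.2, hb.1]⟩
          rw [Set.indicator_of_mem hmem, ← ENNReal.ofReal_mul (by positivity)]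
          apply ENNReal.ofReal_le_ofReal
          by_cases hab : a = b
          · simp only [hab, sub_self]
            norm_num
          have hpos : 0 < |a - b| := abs_pos.2 (sub_ne_zero.2 hab)
          have h1 : |v a - v b| ≤ Λ * |a - b| := by
            have := hΛ.dist_le_mul a b
            rwa [Real.dist_eq, Real.dist_eq] at this
          -- Geometric mean of the two bounds `1` and `M |a - b|`: the Lipschitz bound alone would
          -- give a factor `k`, which the layer measure could not beat.
          have h2 : |endCutoff k a - endCutoff k b| ≤ √M * √|a - b| := by
            rw [← Real.sqrt_mul hM0.le]
            refine Real.le_sqrt_of_sq_le ?_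
            have h3 := abs_endCutoff_sub_le_one k a b
            have h4 := abs_endCutoff_sub_le hL0 hL hk ha hb
            have h5 := abs_nonneg (endCutoff k a - endCutoff k b)
            nlinarith
          have h6 : |a - b| ^ (-(1 / 2) : ℝ) = √|a - b| * |a - b| / (a - b) ^ 2 := by
            rw [Real.rpow_neg hpos.le, ← Real.sqrt_eq_rpow, ← sq_abs (a - b)]
            have h7 : 0 < √|a - b| := Real.sqrt_pos.2 hpos
            field_simp
            rw [Real.sq_sqrt hpos.le]
          rw [h6, mul_div_assoc']
          refine div_le_div_of_nonneg_right ?_ (sq_nonneg _)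
          calc |v a - v b| * |endCutoff k a - endCutoff k b|
              ≤ (Λ * |a - b|) * (√M * √|a - b|) :=
                mul_le_mul h1 h2 (abs_nonneg _) (by positivity)
            _ = _ := by ring
        · simp [endCutoff_sub_eq_zero hk ha hb ha2 hb2])
    refine h.trans ?_
    rw [lintegral_const_mul' _ _ ENNReal.ofReal_ne_top, ← mul_assoc]
    gcongr
    calc _ ≤ 2 * ENNReal.ofReal (2 * (2 / k)) * ENNReal.ofReal (Λ * √M) := by
          gcongr
          exact volume_endLayer_le (by positivity)
      _ = _ := by
          rw [← ENNReal.ofReal_ofNat 2, ← ENNReal.ofReal_mul (by norm_num),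
            ← ENNReal.ofReal_mul (by positivity)]
          congr 1
          rw [hM, Real.sqrt_mul (by positivity)]
          have h7 : 0 < √k := Real.sqrt_pos.2 hk
          field_simp
          rw [Real.sq_sqrt hk.le]
          ring
  have hlim : Tendsto (fun k : ℕ => ENNReal.ofReal (8 * Λ * √(2 * L) / √((k : ℝ) + 1)) * G) atTop
      (𝓝 0) := by
    have h1 : Tendsto (fun k : ℕ => √((k : ℝ) + 1)) atTop atTop :=
      Real.tendsto_sqrt_atTop.comp
        (tendsto_atTop_add_const_right _ _ tendsto_natCast_atTop_atTop)
    have h2 := ENNReal.tendsto_ofReal (h1.const_div_atTop (8 * Λ * √(2 * L)))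
    have h3 := ENNReal.Tendsto.mul_const (b := G) h2
      (Or.inr lintegral_indicator_abs_rpow_ne_top)
    simpa using h3
  exact tendsto_of_tendsto_of_tendsto_of_le_of_le tendsto_const_nhds hlim (fun _ => zero_le)
    fun k => hbound _ (by positivity)

theorem lineEnergy_average_le {v w : ℝ → ℝ} (hv : Continuous v) (hw : Continuous w) (N : ℕ) :
    ((N : ℝ≥0∞) + 1) ^ 2 * lineEnergy (1 / 2) (fun x => (N * v x + w x) / ((N : ℝ) + 1)) ≤
      (N : ℝ≥0∞) ^ 2 * lineEnergy (1 / 2) v + (2 * N * mixedEnergy v w +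
        lineEnergy (1 / 2) w) := by
  have hvm := hv.measurable
  have hwm := hw.measurable
  have hN2 : ((N : ℝ≥0∞) + 1) ^ 2 ≠ ⊤ := by simp
  have hpt : ∀ a b : ℝ, ((N : ℝ≥0∞) + 1) ^ 2 * ENNReal.ofReal
      (((N * v a + w a) / ((N : ℝ) + 1) - (N * v b + w b) / ((N : ℝ) + 1)) ^ 2 / (a - b) ^ 2) ≤
      (N : ℝ≥0∞) ^ 2 * ENNReal.ofReal ((v a - v b) ^ 2 / (a - b) ^ 2) +
      (2 * N * ENNReal.ofReal (|v a - v b| * |w a - w b| / (a - b) ^ 2) +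
      ENNReal.ofReal ((w a - w b) ^ 2 / (a - b) ^ 2)) := by
    intro a b
    have e1 : ((N : ℝ≥0∞) + 1) ^ 2 = ENNReal.ofReal (((N : ℝ) + 1) ^ 2) := by
      rw [ENNReal.ofReal_pow (by positivity), ENNReal.ofReal_add (by positivity) zero_le_one]
      simp
    have e2 : (N : ℝ≥0∞) ^ 2 = ENNReal.ofReal ((N : ℝ) ^ 2) := by
      rw [ENNReal.ofReal_pow (by positivity)]
      simp
    have e3 : 2 * (N : ℝ≥0∞) = ENNReal.ofReal (2 * N) := by
      rw [ENNReal.ofReal_mul (by norm_num)]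
      simp
    rw [e1, e2, e3, ← ENNReal.ofReal_mul (by positivity), ← ENNReal.ofReal_mul (by positivity),
      ← ENNReal.ofReal_mul (by positivity), ← ENNReal.ofReal_add (by positivity) (by positivity),
      ← ENNReal.ofReal_add (by positivity) (by positivity)]
    apply ENNReal.ofReal_le_ofReal
    rw [mul_div_assoc', mul_div_assoc', mul_div_assoc', ← add_div, ← add_div]
    gcongr
    rw [← sub_div, div_pow, mul_div_cancel₀ _ (by positivity)]
    have h1 : (v a - v b) * (w a - w b) ≤ |v a - v b| * |w a - w b| := by
      rw [← abs_mul]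
      exact le_abs_self _
    have h2 : (0 : ℝ) ≤ N := N.cast_nonneg
    nlinarith
  rw [lineEnergy_half, lineEnergy_half, lineEnergy_half, mixedEnergy]
  have m1 : Measurable fun p : ℝ × ℝ => ENNReal.ofReal ((v p.1 - v p.2) ^ 2 / (p.1 - p.2) ^ 2) := by
    fun_prop
  have m2 : Measurable fun p : ℝ × ℝ =>
      ENNReal.ofReal (|v p.1 - v p.2| * |w p.1 - w p.2| / (p.1 - p.2) ^ 2) := by
    fun_prop
  have n1 := m1.lintegral_prod_right' (ν := volume.restrict (Set.Ioo (-1 : ℝ) 1))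
  have n2 := m2.lintegral_prod_right' (ν := volume.restrict (Set.Ioo (-1 : ℝ) 1))
  rw [← lintegral_const_mul' _ _ hN2]
  calc _ ≤ ∫⁻ a in Set.Ioo (-1 : ℝ) 1, ((N : ℝ≥0∞) ^ 2 * (∫⁻ b in Set.Ioo (-1 : ℝ) 1,
        ENNReal.ofReal ((v a - v b) ^ 2 / (a - b) ^ 2)) +
      (2 * N * (∫⁻ b in Set.Ioo (-1 : ℝ) 1,
        ENNReal.ofReal (|v a - v b| * |w a - w b| / (a - b) ^ 2)) +
      ∫⁻ b in Set.Ioo (-1 : ℝ) 1, ENNReal.ofReal ((w a - w b) ^ 2 / (a - b) ^ 2))) := by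
        refine lintegral_mono fun a => ?_
        dsimp only
        have p1 := m1.comp (measurable_prodMk_left (x := a))
        have p2 := m2.comp (measurable_prodMk_left (x := a))
        simp only [Function.comp_def] at p1 p2
        rw [← lintegral_const_mul' _ _ hN2, ← lintegral_const_mul _ p1,
          ← lintegral_const_mul _ p2, ← lintegral_add_left (p2.const_mul _),
          ← lintegral_add_left (p1.const_mul _)]
        exact lintegral_mono fun b => hpt a b
    _ = _ := by
        rw [lintegral_add_left (n1.const_mul _), lintegral_add_left (n2.const_mul _),
          lintegral_const_mul _ n1, lintegral_const_mul _ n2]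

theorem IsLineTest.average {v w : ℝ → ℝ} (hv : IsLineTest v) (hw : IsLineTest w) (N : ℕ) :
    IsLineTest fun x => (N * v x + w x) / ((N : ℝ) + 1) := by
  have hK := hv.2.1.isCompact.union hw.2.1.isCompact
  have hsupp : Function.support (fun x => (N * v x + w x) / ((N : ℝ) + 1)) ⊆
      tsupport v ∪ tsupport w := by
    intro x hx
    by_contra h
    rw [Set.mem_union, not_or] at h
    exact hx (by simp [image_eq_zero_of_notMem_tsupport h.1, image_eq_zero_of_notMem_tsupport h.2])
  refine ⟨?_, HasCompactSupport.of_support_subset_isCompact hK hsupp,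
    (closure_minimal hsupp hK.isClosed).trans (Set.union_subset hv.2.2 hw.2.2)⟩
  exact ((contDiff_const.mul hv.1).add hw.1).div_const _

theorem endCutoff_eq_one_of_four_le {k : ℝ} (hk : 4 ≤ k) {x : ℝ}
    (hx : x ∈ Set.Ioo (-(1 / 2) : ℝ) (1 / 2)) : endCutoff k x = 1 := by
  refine Real.smoothTransition.one_of_one_le ?_
  have h1 : x ^ 2 ≤ 1 / 4 := by nlinarith [hx.1, hx.2]
  nlinarith

/-- Averages of end cutoffs have arbitrarily small energy of order `1 / 2`. -/
theorem exists_isLineTest_lineEnergy_half_le :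
    ∃ B : ℝ≥0∞, B ≠ ⊤ ∧ ∀ N : ℕ, ∃ v, IsLineTest v ∧
      (∀ x ∈ Set.Ioo (-(1 / 2) : ℝ) (1 / 2), v x = 1) ∧
      ((N : ℝ≥0∞) + 1) * lineEnergy (1 / 2) v ≤ B := by
  obtain ⟨B, hB0, hBt, hB⟩ := exists_lineEnergy_endCutoff_le
  refine ⟨2 * B, ENNReal.mul_ne_top (by simp) hBt, fun N => ?_⟩
  induction N with
  | zero =>
    refine ⟨endCutoff 4, isLineTest_endCutoff (by norm_num),
      fun x hx => endCutoff_eq_one_of_four_le le_rfl hx, ?_⟩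
    simp only [Nat.cast_zero, zero_add, one_mul]
    refine (hB 4 (by norm_num)).trans ?_
    rw [two_mul]
    exact le_self_add
  | succ N ih =>
    obtain ⟨v, hv, hv1, hvE⟩ := ih
    -- The tolerance makes the cross term `2 (N+1) * mixedEnergy` at most `B`. Together with the new
    -- cutoff's own energy `B`, each step adds `2B`: `(N+2)² E ≤ (N+1) 2B + 2B = (N+2) 2B`.
    have hsmall : 0 < B / (2 * (N + 1 : ℕ)) :=
      ENNReal.div_pos hB0.ne' (ENNReal.mul_ne_top (by simp) (ENNReal.natCast_ne_top _))
    -- The condition `k ≥ 3` gives the parameter `k + 1 ≥ 4`, for which the cutoff equals `1` on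
    -- `(-1/2, 1/2)`.
    obtain ⟨k, hk, hk4⟩ := (((tendsto_mixedEnergy_endCutoff hv).eventually
      (gt_mem_nhds hsmall)).and (Filter.eventually_ge_atTop 3)).exists
    have hk0 : (0 : ℝ) < k + 1 := by positivity
    have hk4' : (4 : ℝ) ≤ k + 1 := by
      have : (3 : ℝ) ≤ k := by exact_mod_cast hk4
      linarith
    refine ⟨_, hv.average (isLineTest_endCutoff hk0) (N + 1), fun x hx => ?_, ?_⟩
    · rw [hv1 x hx, endCutoff_eq_one_of_four_le hk4' hx, mul_one]
      exact div_self (by positivity)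
    have hM0 : ((N + 1 : ℕ) : ℝ≥0∞) + 1 ≠ 0 := by simp
    have hMt : ((N + 1 : ℕ) : ℝ≥0∞) + 1 ≠ ⊤ :=
      ENNReal.add_ne_top.2 ⟨ENNReal.natCast_ne_top _, ENNReal.one_ne_top⟩
    rw [← ENNReal.mul_le_mul_iff_right hM0 hMt, ← mul_assoc, ← sq]
    refine (lineEnergy_average_le hv.1.continuous (isLineTest_endCutoff hk0).1.continuous
      (N + 1)).trans ?_
    have hX : 2 * ((N + 1 : ℕ) : ℝ≥0∞) * mixedEnergy v (endCutoff (k + 1)) ≤ B := by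
      calc _ ≤ 2 * ((N + 1 : ℕ) : ℝ≥0∞) * (B / (2 * (N + 1 : ℕ))) := by gcongr
        _ = B := ENNReal.mul_div_cancel (by simp)
            (ENNReal.mul_ne_top (by simp) (ENNReal.natCast_ne_top _))
    have hvE' : ((N + 1 : ℕ) : ℝ≥0∞) ^ 2 * lineEnergy (1 / 2) v ≤
        ((N + 1 : ℕ) : ℝ≥0∞) * (2 * B) := by
      rw [sq, mul_assoc]
      refine mul_le_mul_right ?_ _
      push_cast
      exact hvE
    calc _ ≤ ((N + 1 : ℕ) : ℝ≥0∞) * (2 * B) + (B + B) :=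
          add_le_add hvE' (add_le_add hX (hB _ hk0))
      _ = _ := by ring

/-- Since `|a - b| / 2 ≤ 1` and `1 + 2s ≤ 2`, one has `(|a-b|/2)² ≤ (|a-b|/2)^(1+2s) ≤
|a-b|^(1+2s)`; the `4` is the square of the length of the interval. -/
theorem lineEnergy_le_lineEnergy_half {s : ℝ} (hs : 0 < s) (hs2 : s ≤ 1 / 2) (v : ℝ → ℝ) :
    lineEnergy s v ≤ 4 * lineEnergy (1 / 2) v := by
  rw [lineEnergy_half, ← lintegral_const_mul' _ _ (by simp)]
  unfold lineEnergy
  refine setLIntegral_mono' measurableSet_Ioo fun a ha => ?_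
  rw [← lintegral_const_mul' _ _ (by simp)]
  refine setLIntegral_mono' measurableSet_Ioo fun b hb => ?_
  rw [← ENNReal.ofReal_ofNat 4, ← ENNReal.ofReal_mul (by norm_num)]
  apply ENNReal.ofReal_le_ofReal
  by_cases hab : a = b
  · simp [hab]
  have hpos : 0 < |a - b| := abs_pos.2 (sub_ne_zero.2 hab)
  have hle : |a - b| ≤ 2 := by
    rw [abs_le]
    constructor <;> linarith [ha.1, ha.2, hb.1, hb.2]
  have h1 : (|a - b| / 2) ^ (2 : ℝ) ≤ (|a - b| / 2) ^ (1 + 2 * s) :=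
    Real.rpow_le_rpow_of_exponent_ge (by positivity) (by linarith) (by linarith)
  have h2 : (|a - b| / 2) ^ (1 + 2 * s) ≤ |a - b| ^ (1 + 2 * s) :=
    Real.rpow_le_rpow (by positivity) (by linarith) (by linarith)
  have h3 : (|a - b| / 2) ^ (2 : ℝ) = (a - b) ^ 2 / 4 := by
    rw [Real.rpow_two, div_pow, sq_abs]
    norm_num
  have h4 : (a - b) ^ 2 / 4 ≤ |a - b| ^ (1 + 2 * s) := by
    rw [← h3]
    exact h1.trans h2
  have h5 : 0 < (a - b) ^ 2 := by
    have := sub_ne_zero.2 hab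
    positivity
  rw [mul_div_assoc', div_le_div_iff₀ (by positivity) h5]
  nlinarith [sq_nonneg (v a - v b)]

/-- The averaged cutoffs have mass at least `1`, being `1` on an interval of length `1`, and energy
`O(1/N)`. A positive lower bound `c` would make `N c` bounded in `N`. -/
theorem regionalPoincare_interval11_eq_zero {s : ℝ} (hs : 0 < s) (hs2 : s ≤ 1 / 2) :
    regionalPoincare 1 s interval11 = 0 := by
  have hs1 : s < 1 := by linarith
  obtain ⟨B, hBt, hB⟩ := exists_isLineTest_lineEnergy_half_le
  by_contra hne
  obtain ⟨c, hc0, hc⟩ := ENNReal.lt_iff_exists_nnreal_btwn.1 (pos_iff_ne_zero.2 hne)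
  have h := (le_regionalPoincare_interval11_iff hs hs1 ENNReal.coe_ne_top).1 hc.le
  set K := ENNReal.ofReal (fracConst 1 s / 2) * (4 * B) with hK
  have hKt : K ≠ ⊤ := ENNReal.mul_ne_top ENNReal.ofReal_ne_top (ENNReal.mul_ne_top (by simp) hBt)
  obtain ⟨N, hN⟩ := ENNReal.exists_nat_mul_gt hc0.ne' hKt
  refine absurd hN (not_lt.2 ?_)
  obtain ⟨v, hv, hv1, hvE⟩ := hB N
  have hl : 1 ≤ lineL2 v := by
    calc (1 : ℝ≥0∞) = ∫⁻ x in Set.Ioo (-(1 / 2) : ℝ) (1 / 2), 1 := by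
          rw [setLIntegral_one, Real.volume_Ioo]
          norm_num
      _ = ∫⁻ x in Set.Ioo (-(1 / 2) : ℝ) (1 / 2), ENNReal.ofReal (v x ^ 2) := by
          refine setLIntegral_congr_fun measurableSet_Ioo fun x hx => ?_
          simp [hv1 x hx]
      _ ≤ _ := lintegral_mono_set (Set.Ioo_subset_Ioo (by norm_num) (by norm_num))
  calc (N : ℝ≥0∞) * c ≤ (N + 1) * (c * lineL2 v) := by
        gcongr
        · exact le_self_add
        · exact le_mul_of_one_le_right zero_le hl
    _ ≤ (N + 1) * (ENNReal.ofReal (fracConst 1 s / 2) * (4 * lineEnergy (1 / 2) v)) := by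
        refine mul_le_mul_right ((h v hv).trans ?_) _
        gcongr
        exact lineEnergy_le_lineEnergy_half hs hs2 v
    _ = ENNReal.ofReal (fracConst 1 s / 2) * (4 * ((N + 1) * lineEnergy (1 / 2) v)) := by ring
    _ ≤ K := by
        rw [hK]
        gcongr

theorem theorem1p1 (d : ℕ) (s : ℝ) :
    (0 < s → s ≤ 1 / 2 →
      regionalPoincare (d + 1) s (strip d) = 0 ∧ regionalPoincare 1 s interval11 = 0) ∧
    (1 / 2 < s → s < 1 →
      0 < regionalPoincare (d + 1) s (strip d) ∧
        regionalPoincare (d + 1) s (strip d) = regionalPoincare 1 s interval11) := by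
  refine ⟨fun hs hs2 => ?_, fun hs hs1 => ?_⟩
  · rw [regionalPoincare_strip_eq hs (by linarith)]
    exact ⟨regionalPoincare_interval11_eq_zero hs hs2, regionalPoincare_interval11_eq_zero hs hs2⟩
  · rw [regionalPoincare_strip_eq (by linarith) hs1]
    exact ⟨regionalPoincare_interval11_pos hs hs1, rfl⟩
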